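/- Let $\beta\in(0,1)$, let $U$ be a random variable uniformly distributed on $(0,1)$, and set $$b_\beta(u)=\frac{\sin(\pi u)}{\sin^{\beta}(\pi\beta u)\,\sin^{1-\beta}(\pi(1-\beta)u)}\quad(0<u<1),\qquad \kappa_\beta=\beta^{-\beta}(1-\beta)^{\beta-1},$$ $$K_\beta=\kappa_\beta^{-1}\,b_\beta(U),\qquad W_\beta=-\log K_\beta .$$ A random variable $X$ that is almost surely non-negative is called self-decomposable with drift coefficient $a\ge 0$ and spectral function $\varphi$ if $\varphi:(0,\infty)\to[0,\infty)$ is non-increasing and $$\mathbb{E}[e^{-\lambda X}]=\exp\left(-\left[a\lambda+\int_0^\infty(1-e^{-\lambda x})\,\frac{\varphi(x)}{x}\,dx\right]\right)\qquad\text{for all }\lambda\ge 0,$$ where the integral converges. Then $W_\beta$ is almost surely non-negative and is self-decomposable with drift coefficient $0$ and a (non-increasing) spectral function $\varphi_\beta$ satisfying $\varphi_\beta(0+)=\lim_{x\downarrow 0}\varphi_\beta(x)=1/2$. Moreover these data do not depend on the representation: whenever $W_\beta$ is self-decomposable with drift coefficient $a$ and spectral function $\varphi$, one has $a=0$ and $\varphi(0+)=1/2$.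 -/

import Mathlib

open MeasureTheory Set Filter Topology

noncomputable section

/-- `b_c(u) = sin(πu) / (sin^c(πcu) sin^{1-c}(π(1-c)u))`, for `u, c ∈ (0,1)`. -/
def kanterB (c u : ℝ) : ℝ :=
  Real.sin (Real.pi * u) /
    (Real.sin (Real.pi * c * u) ^ c * Real.sin (Real.pi * (1 - c) * u) ^ (1 - c))

/-- `κ_c = c^{-c} (1-c)^{c-1}`. -/
def kanterKappa (c : ℝ) : ℝ :=
  c ^ (-c) * (1 - c) ^ (c - 1)

/-- The normalized Kanter random variable `K_c = κ_c⁻¹ b_c(U)`. -/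
def kanterK {Ω : Type*} (c : ℝ) (U : Ω → ℝ) (ω : Ω) : ℝ :=
  (kanterKappa c)⁻¹ * kanterB c (U ω)

/-- `W_c = -log K_c`. -/
def kanterW {Ω : Type*} (c : ℝ) (U : Ω → ℝ) (ω : Ω) : ℝ :=
  -Real.log (kanterK c U ω)

/-- The positive random variable `X` is self-decomposable with drift coefficient `a ≥ 0` and
spectral function `φ : (0,∞) → ℝ⁺` (non-increasing): for all `s ≥ 0`,
`E[e^{-sX}] = exp(-(a s + ∫₀^∞ (1 - e^{-sx}) φ(x)/x dx))`, with a convergent integral.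
Only the values of `φ` on `(0,∞)` matter. -/
structure IsSelfDecomposableWith {Ω : Type*} [MeasurableSpace Ω] (P : Measure Ω)
    (X : Ω → ℝ) (a : ℝ) (φ : ℝ → ℝ) : Prop where
  aemeasurable : AEMeasurable X P
  nonneg : ∀ᵐ ω ∂P, 0 ≤ X ω
  drift_nonneg : 0 ≤ a
  spectral_nonneg : ∀ x ∈ Ioi (0 : ℝ), 0 ≤ φ x
  spectral_antitone : AntitoneOn φ (Ioi 0)
  integrable : ∀ s : ℝ, 0 ≤ s →
    IntegrableOn (fun x => (1 - Real.exp (-s * x)) * (φ x / x)) (Ioi 0)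
  laplace : ∀ s : ℝ, 0 ≤ s →
    ∫ ω, Real.exp (-s * X ω) ∂P =
      Real.exp (-(a * s + ∫ x in Ioi (0 : ℝ), (1 - Real.exp (-s * x)) * (φ x / x)))

end

/-! Since `E[e^{-sW}] = E[K^s]`, everything rests on the moment formula `E[b(U)^s] = Γ(1+s) /
(Γ(1+βs) Γ(1+(1-β)s))` (`mgf_log_kanterB`).

Malmsten's integral for `log Γ(1+s)`, rescaled by `x ↦ x/β` and `x ↦ x/(1-β)`, turns this quotient
into a Laplace exponent with spectral function `kanterSpectral`. The rescaling leaves Frullani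
integrals linear in `s`, which the factor `κ^{-s}` cancels exactly; hence no drift. Monotonicity
comes from convexity of `sinh`. At zero, `1/(e^x-1) = 1/x - 1/2 + o(1)`: the poles cancel because `1
= β + (1-β)`, and `1/2` remains.

For `-1 < s < 0` the moment is a contour integral. On the curve `arg(1+ζ) = β arg ζ`, parametrized
by `y = arg ζ`, the form `ζ^{-βs} (1+ζ)^s dζ/ζ` has imaginary part `b(y/π)^s dy`. It has the
primitive `ζ^{-βs} rayIntegral ζ`, real at the starting point on the positive axis and a Beta
integral times a phase at the endpoint `-1`; the reflection formula finishes. The identity theorem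
extends the result to all `s > -1`.

For uniqueness, two representations have equal exponents `Ψ`. The increment `Ψ(2s) - Ψ(s)` is `a s`
plus an average of `φ(x/s)` of total weight `log 2`. It is bounded for the known representation, so
`a = 0`; letting `s → ∞` reads off `φ(0+)`. -/

/-- The function `x ↦ 1 / (e^x - 1)`. -/
noncomputable def bose (x : ℝ) : ℝ := (Real.exp x - 1)⁻¹

/-- The spectral function `1/(e^x-1) - 1/(e^{x/c}-1) - 1/(e^{x/(1-c)}-1)` of `-log K_c`. -/
noncomputable def kanterSpectral (c x : ℝ) : ℝ :=
  bose x - bose (x / c) - bose (x / (1 - c))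

/-- The integrand in Malmsten's formula for `log Γ(1+s)`. -/
noncomputable def malmstenIntegrand (s x : ℝ) : ℝ :=
  (s * Real.exp (-x) - (1 - Real.exp (-s * x)) * bose x) / x

theorem measurable_bose : Measurable bose := by unfold bose; fun_prop

theorem exp_sub_one_pos {x : ℝ} (hx : 0 < x) : 0 < Real.exp x - 1 := by
  have := Real.add_one_lt_exp hx.ne'
  linarith

theorem bose_pos {x : ℝ} (hx : 0 < x) : 0 < bose x := inv_pos.2 (exp_sub_one_pos hx)

/-! ### Frullani integrals of exponentials -/

theorem integrableOn_exp_neg_mul_Ioi {a : ℝ} (ha : 0 < a) :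
    IntegrableOn (fun x => Real.exp (-(a * x))) (Ioi 0) := by
  simpa only [neg_mul] using exp_neg_integrableOn_Ioi 0 ha

theorem integrableOn_exp_sub_exp_div_of_le {a b : ℝ} (ha : 0 < a) (hab : a ≤ b) :
    IntegrableOn (fun x => (Real.exp (-(a * x)) - Real.exp (-(b * x))) / x) (Ioi 0) := by
  refine Integrable.mono' ((integrableOn_exp_neg_mul_Ioi ha).const_mul (b - a))
    (Measurable.aestronglyMeasurable (by fun_prop)) ?_
  refine (ae_restrict_mem measurableSet_Ioi).mono fun x hx => ?_
  have hx : 0 < x := hx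
  have h1 : Real.exp (-(b * x)) = Real.exp (-(a * x)) * Real.exp (-((b - a) * x)) := by
    rw [← Real.exp_add]; ring_nf
  have h2 := Real.one_sub_le_exp_neg ((b - a) * x)
  have h3 : Real.exp (-((b - a) * x)) ≤ 1 :=
    Real.exp_le_one_iff.2 (by nlinarith [mul_nonneg (sub_nonneg.2 hab) hx.le])
  have h4 := Real.exp_pos (-(a * x))
  rw [h1, Real.norm_of_nonneg (div_nonneg (by nlinarith) hx.le), div_le_iff₀ hx]
  nlinarith

theorem integrableOn_exp_sub_exp_div {a b : ℝ} (ha : 0 < a) (hb : 0 < b) :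
    IntegrableOn (fun x => (Real.exp (-(a * x)) - Real.exp (-(b * x))) / x) (Ioi 0) := by
  rcases le_total a b with h | h
  · exact integrableOn_exp_sub_exp_div_of_le ha h
  · refine (integrableOn_exp_sub_exp_div_of_le hb h).neg.congr_fun (fun x _ => ?_)
      measurableSet_Ioi
    simp only [Pi.neg_apply]
    ring

theorem integral_exp_sub_exp_div {a b : ℝ} (ha : 0 < a) (hb : 0 < b) :
    ∫ x in Ioi (0 : ℝ), (Real.exp (-(a * x)) - Real.exp (-(b * x))) / x = Real.log (b / a) := by
  have hc : Continuous fun x : ℝ => Real.exp (-x) := by fun_prop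
  have key := Frullani.integral_Ioi_eq (f := fun x : ℝ => Real.exp (-x)) (L := 1) (R := 0)
    (hc.locallyIntegrable.locallyIntegrableOn _) ha hb
    (by simpa using (hc.tendsto 0).mono_left nhdsWithin_le_nhds)
    Real.tendsto_exp_neg_atTop_nhds_zero
    ((integrableOn_exp_sub_exp_div ha hb).congr_fun
      (fun x _ => by simp [div_eq_inv_mul]) measurableSet_Ioi)
  simpa [div_eq_inv_mul] using key

/-! ### Malmsten's formula -/

/-- Follows from `1 + y + y²/2 ≤ e^y` and `(1 + y + y²/2)(1 - y + y²/2) = 1 + y⁴/4`. -/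
theorem exp_neg_le_quadratic {y : ℝ} (hy : 0 ≤ y) : Real.exp (-y) ≤ 1 - y + y ^ 2 / 2 := by
  have h1 := Real.quadratic_le_exp_of_nonneg hy
  have h3 : 0 < 1 - y + y ^ 2 / 2 := by nlinarith [sq_nonneg (y - 1)]
  rw [Real.exp_neg]
  refine inv_le_of_inv_le₀ h3 (le_trans ?_ h1)
  rw [inv_le_iff_one_le_mul₀ h3]
  nlinarith [sq_nonneg (y ^ 2)]

theorem mul_bose_le {x : ℝ} (hx : 0 < x) : x * bose x ≤ Real.exp (-(1 / 2 * x)) := by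
  have h1 : x / 2 ≤ Real.sinh (x / 2) := Real.self_le_sinh_iff.2 (by positivity)
  rw [Real.sinh_eq] at h1
  have h2 : Real.exp (-(1 / 2 * x)) * (Real.exp x - 1) =
      Real.exp (x / 2) - Real.exp (-(x / 2)) := by
    rw [mul_sub, ← Real.exp_add]; ring_nf
  rw [bose, ← div_eq_mul_inv, div_le_iff₀ (exp_sub_one_pos hx), h2]
  linarith

/-- Uses `e^{-x} = bose x * (1 - e^{-x})`. In this form the first-order terms at `x = 0` visibly
cancel, and so does everything when `s = 1`. -/
theorem malmstenIntegrand_eq {x : ℝ} (hx : 0 < x) (s : ℝ) :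
    malmstenIntegrand s x =
      bose x * (s * (1 - Real.exp (-x)) - (1 - Real.exp (-s * x))) / x := by
  have h1 : Real.exp (-x) = bose x * (1 - Real.exp (-x)) := by
    have := exp_sub_one_pos hx
    rw [bose, Real.exp_neg]
    have := Real.exp_pos x
    field_simp
  rw [malmstenIntegrand]
  congr 1
  linear_combination s * h1

theorem integrableOn_malmstenIntegrand {s : ℝ} (hs : 0 ≤ s) :
    IntegrableOn (malmstenIntegrand s) (Ioi 0) := by
  have hm := measurable_bose
  refine Integrable.mono' ((integrableOn_exp_neg_mul_Ioi (a := 1 / 2) (by norm_num)).const_mul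
    ((s + s ^ 2) / 2))
    (Measurable.aestronglyMeasurable (by unfold malmstenIntegrand; fun_prop)) ?_
  refine (ae_restrict_mem measurableSet_Ioi).mono fun x hx => ?_
  have hx : 0 < x := hx
  have hsx : 0 ≤ s * x := by positivity
  have h1 := exp_neg_le_quadratic hx.le
  have h2 := exp_neg_le_quadratic hsx
  have h3 := Real.one_sub_le_exp_neg x
  have h4 := Real.one_sub_le_exp_neg (s * x)
  have hD : |s * (1 - Real.exp (-x)) - (1 - Real.exp (-s * x))| ≤ (s + s ^ 2) / 2 * x ^ 2 := by
    rw [neg_mul, abs_le]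
    constructor <;> nlinarith [mul_le_mul_of_nonneg_left h1 hs, mul_le_mul_of_nonneg_left h3 hs,
      mul_nonneg hs (sq_nonneg x), sq_nonneg (s * x)]
  rw [malmstenIntegrand_eq hx, norm_div, norm_mul, Real.norm_of_nonneg (bose_pos hx).le,
    Real.norm_of_nonneg hx.le, div_le_iff₀ hx, Real.norm_eq_abs]
  calc bose x * |s * (1 - Real.exp (-x)) - (1 - Real.exp (-s * x))|
      ≤ bose x * ((s + s ^ 2) / 2 * x ^ 2) := mul_le_mul_of_nonneg_left hD (bose_pos hx).le
    _ = (s + s ^ 2) / 2 * x * (x * bose x) := by ring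
    _ ≤ (s + s ^ 2) / 2 * x * Real.exp (-(1 / 2 * x)) :=
        mul_le_mul_of_nonneg_left (mul_bose_le hx) (by positivity)
    _ = _ := by ring

/-- The integrands differ by a Frullani integrand, since `e^{-sx} (1 - e^{-x}) bose x =
e^{-(s+1)x}`. -/
theorem integral_malmstenIntegrand_add_one {s : ℝ} (hs : 0 ≤ s) :
    ∫ x in Ioi (0 : ℝ), malmstenIntegrand (s + 1) x =
      (∫ x in Ioi (0 : ℝ), malmstenIntegrand s x) + Real.log (s + 1) := by
  have h := integral_exp_sub_exp_div (a := 1) (b := s + 1) one_pos (by positivity)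
  rw [div_one] at h
  rw [← h, ← integral_add (integrableOn_malmstenIntegrand hs)
    (integrableOn_exp_sub_exp_div one_pos (by positivity))]
  refine setIntegral_congr_fun measurableSet_Ioi fun x (hx : 0 < x) => ?_
  have h0 := exp_sub_one_pos hx
  simp only [malmstenIntegrand, bose]
  have h1 : Real.exp (-(s + 1) * x) = Real.exp (-s * x) * (Real.exp x)⁻¹ := by
    rw [← Real.exp_neg, ← Real.exp_add]; ring_nf
  have h2 : Real.exp (-((s + 1) * x)) = Real.exp (-s * x) * (Real.exp x)⁻¹ := by
    rw [← Real.exp_neg, ← Real.exp_add]; ring_nf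
  have := Real.exp_pos x
  rw [h1, h2, one_mul, Real.exp_neg x]
  field_simp
  ring

theorem convexOn_integral_malmstenIntegrand :
    ConvexOn ℝ (Ioi 0) fun s => ∫ x in Ioi (0 : ℝ), malmstenIntegrand s x := by
  refine ⟨convex_Ioi 0, fun s (hs : 0 < s) t (ht : 0 < t) a b ha hb hab => ?_⟩
  simp only [smul_eq_mul]
  have hi := integrableOn_malmstenIntegrand hs.le
  have hj := integrableOn_malmstenIntegrand ht.le
  rw [← integral_const_mul, ← integral_const_mul, ← integral_add (hi.const_mul a) (hj.const_mul b)]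
  refine setIntegral_mono_on (integrableOn_malmstenIntegrand (by positivity))
    ((hi.const_mul a).add (hj.const_mul b)) measurableSet_Ioi fun x (hx : 0 < x) => ?_
  have h := convexOn_exp.2 (mem_univ (-s * x)) (mem_univ (-t * x)) ha hb hab
  simp only [smul_eq_mul] at h
  have h' : a * (-s * x) + b * (-t * x) = -(a * s + b * t) * x := by ring
  rw [h'] at h
  simp only [malmstenIntegrand]
  rw [mul_div_assoc', mul_div_assoc', ← add_div]
  refine div_le_div_of_nonneg_right ?_ hx.le
  have := mul_le_mul_of_nonneg_right h (bose_pos hx).le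
  have e : a * bose x + b * bose x = bose x := by rw [← add_mul, hab, one_mul]
  nlinarith

/-- **Malmsten's formula** for the Gamma function. -/
theorem Gamma_add_one_eq_exp_integral {s : ℝ} (hs : 0 ≤ s) :
    Real.Gamma (s + 1) = Real.exp (∫ x in Ioi (0 : ℝ), malmstenIntegrand s x) := by
  rcases hs.eq_or_lt with rfl | hs
  · simp [malmstenIntegrand]
  -- Bohr–Mollerup for `exp(I(y)) / y`, the candidate for `Γ(y)`; the division adds the convex term
  -- `-log y` to the logarithm.
  have key := Real.eq_Gamma_of_log_convex
    (f := fun y => Real.exp (∫ x in Ioi (0 : ℝ), malmstenIntegrand y x) / y) ?_ ?_ ?_ ?_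
  · have := key hs
    simp only at this
    rw [Real.Gamma_add_one hs.ne', ← this]
    field_simp
  · have h2 : ConvexOn ℝ (Ioi 0) fun y => -Real.log y :=
      strictConcaveOn_log_Ioi.concaveOn.neg
    refine (convexOn_integral_malmstenIntegrand.add h2).congr fun y (hy : 0 < y) => ?_
    simp [Real.log_div (Real.exp_pos _).ne' hy.ne', sub_eq_add_neg]
  · intro y hy
    rw [integral_malmstenIntegrand_add_one hy.le, Real.exp_add, Real.exp_log (by positivity)]
    field_simp
  · intro y hy
    positivity
  · have : ∀ x ∈ Ioi (0 : ℝ), malmstenIntegrand 1 x = 0 := fun x (hx : 0 < x) => by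
      rw [malmstenIntegrand_eq hx]; simp
    simp [setIntegral_congr_fun measurableSet_Ioi this]

/-! ### The spectral function -/

theorem sinh_mul_le {c u : ℝ} (hc0 : 0 ≤ c) (hc1 : c ≤ 1) (hu : 0 ≤ u) :
    Real.sinh (c * u) ≤ c * Real.sinh u := by
  have hconv : ConvexOn ℝ (Ici 0) Real.sinh := by
    refine MonotoneOn.convexOn_of_deriv (convex_Ici 0) Real.continuous_sinh.continuousOn
      Real.differentiable_sinh.differentiableOn ?_
    rw [Real.deriv_sinh, interior_Ici]
    intro x (hx : 0 < x) y (hy : 0 < y) hxy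
    rwa [Real.cosh_le_cosh, abs_of_pos hx, abs_of_pos hy]
  have := hconv.2 (mem_Ici.2 hu) (mem_Ici.2 le_rfl) hc0 (sub_nonneg.2 hc1) (by ring)
  simpa using this

theorem exp_div_sq_eq (x : ℝ) :
    Real.exp x / (Real.exp x - 1) ^ 2 = (4 * Real.sinh (x / 2) ^ 2)⁻¹ := by
  have h : Real.exp x = Real.exp (x / 2) ^ 2 := by rw [← Real.exp_nat_mul]; ring_nf
  have hp := Real.exp_pos (x / 2)
  have h1 : 4 * Real.sinh (x / 2) ^ 2 = (Real.exp x - 1) ^ 2 / Real.exp x := by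
    rw [Real.sinh_eq, Real.exp_neg, h]
    field_simp
    ring
  rw [h1, inv_div]

/-- Both sides are of the form `1 / (4 sinh²)`, and `sinh (x/2) ≤ c sinh (x/(2c))` by convexity. -/
theorem exp_div_sq_div_le {c x : ℝ} (hc0 : 0 < c) (hc1 : c ≤ 1) (hx : 0 < x) :
    Real.exp (x / c) / (Real.exp (x / c) - 1) ^ 2 ≤
      c ^ 2 * (Real.exp x / (Real.exp x - 1) ^ 2) := by
  rw [exp_div_sq_eq, exp_div_sq_eq]
  have h := sinh_mul_le hc0.le hc1 (u := x / c / 2) (by positivity)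
  rw [show c * (x / c / 2) = x / 2 by field_simp] at h
  have h1 : 0 < Real.sinh (x / 2) := Real.sinh_pos_iff.2 (by positivity)
  have h2 : 0 < Real.sinh (x / c / 2) := Real.sinh_pos_iff.2 (by positivity)
  rw [← div_eq_mul_inv, le_div_iff₀ (by positivity), inv_mul_le_iff₀ (by positivity)]
  nlinarith [pow_le_pow_left₀ h1.le h 2]

theorem hasDerivAt_bose {x : ℝ} (hx : 0 < x) :
    HasDerivAt bose (-(Real.exp x / (Real.exp x - 1) ^ 2)) x := by
  have := ((Real.hasDerivAt_exp x).sub_const 1).inv (exp_sub_one_pos hx).ne'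
  exact this.congr_deriv (by ring)

theorem hasDerivAt_kanterSpectral {c x : ℝ} (hc : c ∈ Ioo (0 : ℝ) 1) (hx : 0 < x) :
    HasDerivAt (kanterSpectral c)
      (-(Real.exp x / (Real.exp x - 1) ^ 2)
        + Real.exp (x / c) / (Real.exp (x / c) - 1) ^ 2 / c
        + Real.exp (x / (1 - c)) / (Real.exp (x / (1 - c)) - 1) ^ 2 / (1 - c)) x := by
  have hc' : 0 < 1 - c := sub_pos.2 hc.2
  have h1 := (hasDerivAt_bose (div_pos hx hc.1)).comp x ((hasDerivAt_id x).div_const c)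
  have h2 := (hasDerivAt_bose (div_pos hx hc')).comp x ((hasDerivAt_id x).div_const (1 - c))
  exact (((hasDerivAt_bose hx).sub h1).sub h2).congr_deriv (by ring)

theorem antitoneOn_kanterSpectral {c : ℝ} (hc : c ∈ Ioo (0 : ℝ) 1) :
    AntitoneOn (kanterSpectral c) (Ioi 0) := by
  have hc' : 0 < 1 - c := sub_pos.2 hc.2
  refine antitoneOn_of_deriv_nonpos (convex_Ioi 0)
    (fun x hx => (hasDerivAt_kanterSpectral hc hx).continuousAt.continuousWithinAt)
    (fun x hx => (hasDerivAt_kanterSpectral hc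
      (by simpa using hx)).differentiableAt.differentiableWithinAt) fun x hx => ?_
  rw [interior_Ioi] at hx
  rw [(hasDerivAt_kanterSpectral hc hx).deriv]
  have h1 := exp_div_sq_div_le hc.1 hc.2.le hx
  have h2 := exp_div_sq_div_le hc' (by linarith [hc.1]) hx
  -- The chain rule divides by `c` and `1 - c`, so the two positive terms are at most `c p` and `(1
  -- - c) p`, adding up to the negative term `p`.
  have h1' := div_le_div_of_nonneg_right h1 hc.1.le
  have h2' := div_le_div_of_nonneg_right h2 hc'.le
  set p := Real.exp x / (Real.exp x - 1) ^ 2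
  rw [show c ^ 2 * p / c = c * p by field_simp [hc.1.ne']] at h1'
  rw [show (1 - c) ^ 2 * p / (1 - c) = (1 - c) * p by field_simp [hc'.ne']] at h2'
  linarith

theorem tendsto_bose_atTop : Tendsto bose atTop (𝓝 0) :=
  (tendsto_atTop_add_const_right _ (-1) Real.tendsto_exp_atTop).inv_tendsto_atTop

theorem tendsto_kanterSpectral_atTop {c : ℝ} (hc : c ∈ Ioo (0 : ℝ) 1) :
    Tendsto (kanterSpectral c) atTop (𝓝 0) := by
  have h1 := tendsto_bose_atTop.comp (tendsto_id.atTop_div_const hc.1)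
  have h2 := tendsto_bose_atTop.comp (tendsto_id.atTop_div_const (sub_pos.2 hc.2))
  simpa using! (tendsto_bose_atTop.sub h1).sub h2

theorem kanterSpectral_nonneg {c x : ℝ} (hc : c ∈ Ioo (0 : ℝ) 1) (hx : 0 < x) :
    0 ≤ kanterSpectral c x :=
  le_of_tendsto (tendsto_kanterSpectral_atTop hc) <| (eventually_ge_atTop x).mono fun _ hy =>
    antitoneOn_kanterSpectral hc hx (hx.trans_le hy) hy

/-- The difference is minus the quotient of `(e^x - 1 - x)/x² → 1/2` by `(e^x - 1)/x → 1`. -/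
theorem tendsto_bose_sub_inv : Tendsto (fun x => bose x - x⁻¹) (𝓝[>] 0) (𝓝 (-(1 / 2))) := by
  have hr : Tendsto (fun x : ℝ => (Real.exp x - 1 - x) / x ^ 2) (𝓝[>] 0) (𝓝 (1 / 2)) := by
    rw [tendsto_iff_norm_sub_tendsto_zero]
    have hid : Tendsto (fun x : ℝ => x) (𝓝[>] 0) (𝓝 0) := tendsto_id.mono_left nhdsWithin_le_nhds
    refine squeeze_zero' (Eventually.of_forall fun _ => norm_nonneg _) ?_ hid
    filter_upwards [Ioo_mem_nhdsGT (one_pos : (0 : ℝ) < 1)] with x hx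
    have hb := Real.exp_bound (x := x) (by rw [abs_of_pos hx.1]; exact hx.2.le) (n := 3) (by norm_num)
    simp only [Finset.sum_range_succ, Finset.sum_range_zero, Nat.factorial] at hb
    norm_num at hb
    have hx2 : 0 < x ^ 2 := by have := hx.1; positivity
    rw [Real.norm_eq_abs, show (Real.exp x - 1 - x) / x ^ 2 - 1 / 2 =
      (Real.exp x - (1 + x + x ^ 2 / 2)) / x ^ 2 by
        have := hx.1.ne'
        field_simp
        ring, abs_div, abs_of_pos hx2,
      div_le_iff₀ hx2]
    refine hb.trans ?_
    rw [abs_of_pos hx.1]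
    nlinarith [pow_pos hx.1 3]
  have hs : Tendsto (fun x : ℝ => (Real.exp x - 1) / x) (𝓝[>] 0) (𝓝 1) := by
    have := (Real.hasDerivAt_exp 0).tendsto_slope_zero_right
    simpa [div_eq_inv_mul] using this
  have h := (hr.div hs one_ne_zero).neg
  rw [div_one] at h
  refine h.congr' ?_
  filter_upwards [self_mem_nhdsWithin] with x (hx : 0 < x)
  have := (exp_sub_one_pos hx).ne'
  simp only [Pi.div_apply, bose]
  field_simp
  ring

theorem tendsto_bose_div_sub {c : ℝ} (hc : 0 < c) :
    Tendsto (fun x => bose (x / c) - c * x⁻¹) (𝓝[>] 0) (𝓝 (-(1 / 2))) := by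
  have h : Tendsto (fun x : ℝ => x / c) (𝓝[>] 0) (𝓝[>] 0) := by
    refine tendsto_nhdsWithin_iff.2 ⟨?_, ?_⟩
    · have : Continuous fun x : ℝ => x / c := by fun_prop
      simpa using (this.tendsto 0).mono_left nhdsWithin_le_nhds
    · filter_upwards [self_mem_nhdsWithin] with x hx using div_pos hx hc
  refine (tendsto_bose_sub_inv.comp h).congr fun x => ?_
  simp [div_eq_mul_inv]

theorem tendsto_kanterSpectral_zero {c : ℝ} (hc : c ∈ Ioo (0 : ℝ) 1) :
    Tendsto (kanterSpectral c) (𝓝[>] 0) (𝓝 (1 / 2)) := by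
  have h := (tendsto_bose_sub_inv.sub (tendsto_bose_div_sub hc.1)).sub
    (tendsto_bose_div_sub (sub_pos.2 hc.2))
  convert h using 2
  · rw [kanterSpectral]; ring
  · norm_num

/-- Rescaling makes the `bose` terms match but changes the linear terms `e^{-x}` into `e^{-x/c}` and
`e^{-x/(1-c)}`; the Frullani integrands repair this. -/
theorem kanterSpectral_integrand_eq {c : ℝ} (hc : c ∈ Ioo (0 : ℝ) 1) (s x : ℝ) :
    (1 - Real.exp (-s * x)) * (kanterSpectral c x / x) =
      -malmstenIntegrand s x + c⁻¹ * malmstenIntegrand (c * s) (c⁻¹ * x)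
        + (1 - c)⁻¹ * malmstenIntegrand ((1 - c) * s) ((1 - c)⁻¹ * x)
        + (s * c * ((Real.exp (-(1 * x)) - Real.exp (-(c⁻¹ * x))) / x)
        + s * (1 - c) * ((Real.exp (-(1 * x)) - Real.exp (-((1 - c)⁻¹ * x))) / x)) := by
  have hc0 : c ≠ 0 := hc.1.ne'
  have hc' : 1 - c ≠ 0 := (sub_pos.2 hc.2).ne'
  have e1 : -(c * s) * (c⁻¹ * x) = -s * x := by field_simp
  have e2 : -((1 - c) * s) * ((1 - c)⁻¹ * x) = -s * x := by field_simp
  simp only [malmstenIntegrand, kanterSpectral, e1, e2, div_eq_inv_mul, one_mul, mul_inv, inv_inv]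
  field_simp
  ring

theorem integrableOn_comp_inv_mul {f : ℝ → ℝ} (hf : IntegrableOn f (Ioi 0)) {c : ℝ} (hc : 0 < c) :
    IntegrableOn (fun x => c⁻¹ * f (c⁻¹ * x)) (Ioi 0) := by
  have := (integrableOn_Ioi_comp_mul_left_iff f 0 (inv_pos.2 hc)).2 (by simpa using hf)
  exact this.const_mul _

theorem integral_comp_inv_mul (f : ℝ → ℝ) {c : ℝ} (hc : 0 < c) :
    ∫ x in Ioi (0 : ℝ), c⁻¹ * f (c⁻¹ * x) = ∫ x in Ioi (0 : ℝ), f x := by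
  rw [integral_const_mul, integral_comp_mul_left_Ioi f 0 (inv_pos.2 hc)]
  simp [hc.ne']

theorem integrableOn_kanterSpectral {c : ℝ} (hc : c ∈ Ioo (0 : ℝ) 1) {s : ℝ} (hs : 0 ≤ s) :
    IntegrableOn (fun x => (1 - Real.exp (-s * x)) * (kanterSpectral c x / x)) (Ioi 0) := by
  have hc' : 0 < 1 - c := sub_pos.2 hc.2
  simp only [kanterSpectral_integrand_eq hc]
  have i1 := integrableOn_malmstenIntegrand hs
  have i2 := integrableOn_comp_inv_mul
    (integrableOn_malmstenIntegrand (mul_nonneg hc.1.le hs)) hc.1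
  have i3 := integrableOn_comp_inv_mul
    (integrableOn_malmstenIntegrand (mul_nonneg hc'.le hs)) hc'
  have i4 := (integrableOn_exp_sub_exp_div one_pos (inv_pos.2 hc.1)).const_mul (s * c)
  have i5 := (integrableOn_exp_sub_exp_div one_pos (inv_pos.2 hc')).const_mul (s * (1 - c))
  exact ((i1.neg.add i2).add i3).add (i4.add i5)

theorem integral_kanterSpectral {c : ℝ} (hc : c ∈ Ioo (0 : ℝ) 1) {s : ℝ} (hs : 0 ≤ s) :
    ∫ x in Ioi (0 : ℝ), (1 - Real.exp (-s * x)) * (kanterSpectral c x / x) =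
      -(∫ x in Ioi (0 : ℝ), malmstenIntegrand s x)
        + (∫ x in Ioi (0 : ℝ), malmstenIntegrand (c * s) x)
        + (∫ x in Ioi (0 : ℝ), malmstenIntegrand ((1 - c) * s) x)
        - s * (c * Real.log c + (1 - c) * Real.log (1 - c)) := by
  have hc' : 0 < 1 - c := sub_pos.2 hc.2
  simp only [kanterSpectral_integrand_eq hc]
  have i1 := integrableOn_malmstenIntegrand hs
  have i2 := integrableOn_comp_inv_mul
    (integrableOn_malmstenIntegrand (mul_nonneg hc.1.le hs)) hc.1
  have i3 := integrableOn_comp_inv_mul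
    (integrableOn_malmstenIntegrand (mul_nonneg hc'.le hs)) hc'
  have i4 := (integrableOn_exp_sub_exp_div one_pos (inv_pos.2 hc.1)).const_mul (s * c)
  have i5 := (integrableOn_exp_sub_exp_div one_pos (inv_pos.2 hc')).const_mul (s * (1 - c))
  have i12 : IntegrableOn (fun x => -malmstenIntegrand s x
      + c⁻¹ * malmstenIntegrand (c * s) (c⁻¹ * x)) (Ioi 0) := i1.neg.add i2
  rw [integral_add (by exact i12.add i3) (by exact i4.add i5), integral_add i12 i3,
    integral_add (by exact i1.neg) i2, integral_add i4 i5, integral_neg, integral_comp_inv_mul _ hc.1,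
    integral_comp_inv_mul _ hc', integral_const_mul, integral_const_mul,
    integral_exp_sub_exp_div one_pos (inv_pos.2 hc.1),
    integral_exp_sub_exp_div one_pos (inv_pos.2 hc'), div_one, div_one, Real.log_inv, Real.log_inv]
  ring

theorem log_kanterKappa {c : ℝ} (hc : c ∈ Ioo (0 : ℝ) 1) :
    Real.log (kanterKappa c) = -(c * Real.log c + (1 - c) * Real.log (1 - c)) := by
  have hc' : 0 < 1 - c := sub_pos.2 hc.2
  rw [kanterKappa, Real.log_mul (Real.rpow_pos_of_pos hc.1 _).ne' (Real.rpow_pos_of_pos hc' _).ne',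
    Real.log_rpow hc.1, Real.log_rpow hc']
  ring

/-- The Frullani terms add up to exactly `s log κ`, which is why no drift is needed. -/
theorem exp_neg_integral_kanterSpectral {c : ℝ} (hc : c ∈ Ioo (0 : ℝ) 1) {s : ℝ} (hs : 0 ≤ s) :
    Real.exp (-∫ x in Ioi (0 : ℝ), (1 - Real.exp (-s * x)) * (kanterSpectral c x / x)) =
      Real.exp (-s * Real.log (kanterKappa c)) *
        (Real.Gamma (s + 1) / (Real.Gamma (c * s + 1) * Real.Gamma ((1 - c) * s + 1))) := by
  have hc' : 0 < 1 - c := sub_pos.2 hc.2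
  rw [Gamma_add_one_eq_exp_integral hs, Gamma_add_one_eq_exp_integral (mul_nonneg hc.1.le hs),
    Gamma_add_one_eq_exp_integral (mul_nonneg hc'.le hs), ← Real.exp_add, ← Real.exp_sub,
    ← Real.exp_add, integral_kanterSpectral hc hs, log_kanterKappa hc]
  congr 1
  ring

/-! ### Uniqueness of the drift and of the spectral function at zero -/

/-- The increment `Ψ(2s) - Ψ(s)` of the exponent with spectral function `ψ` and no drift. -/
noncomputable def exponentIncrement (ψ : ℝ → ℝ) (s : ℝ) : ℝ :=
  ∫ x in Ioi (0 : ℝ), (Real.exp (-(1 * x)) - Real.exp (-(2 * x))) / x * ψ (x / s)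

theorem exp_neg_sub_exp_neg_two_mul_pos {x : ℝ} (hx : 0 < x) :
    0 < (Real.exp (-(1 * x)) - Real.exp (-(2 * x))) / x :=
  div_pos (sub_pos.2 (Real.exp_lt_exp.2 (by linarith))) hx

section

variable {ψ : ℝ → ℝ} (hint : ∀ s : ℝ, 0 ≤ s →
  IntegrableOn (fun x => (1 - Real.exp (-s * x)) * (ψ x / x)) (Ioi 0))

include hint

theorem integrableOn_exponentIncrement {s : ℝ} (hs : 0 < s) :
    IntegrableOn (fun x => (Real.exp (-(1 * x)) - Real.exp (-(2 * x))) / x * ψ (x / s))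
      (Ioi 0) := by
  have h := integrableOn_comp_inv_mul ((hint (2 * s) (by positivity)).sub (hint s hs.le)) hs
  refine h.congr_fun (fun x (hx : 0 < x) => ?_) measurableSet_Ioi
  have e1 : -(2 * s) * (s⁻¹ * x) = -(2 * x) := by field_simp
  have e2 : -s * (s⁻¹ * x) = -(1 * x) := by field_simp
  simp only [Pi.sub_apply, e1, e2, div_eq_inv_mul]
  field_simp
  ring

/-- Scale invariance of `dx/x` moves all dependence on `s` into `ψ (x / s)`, so large `s` probes `ψ`
near zero. -/
theorem integral_sub_eq_exponentIncrement {s : ℝ} (hs : 0 < s) :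
    (∫ x in Ioi (0 : ℝ), (1 - Real.exp (-(2 * s) * x)) * (ψ x / x)) -
      ∫ x in Ioi (0 : ℝ), (1 - Real.exp (-s * x)) * (ψ x / x) = exponentIncrement ψ s := by
  rw [← integral_sub (hint (2 * s) (by positivity)) (hint s hs.le),
    ← integral_comp_inv_mul _ hs, exponentIncrement]
  refine setIntegral_congr_fun measurableSet_Ioi (fun x (hx : 0 < x) => ?_)
  have e1 : -(2 * s) * (s⁻¹ * x) = -(2 * x) := by field_simp
  have e2 : -s * (s⁻¹ * x) = -(1 * x) := by field_simp
  simp only [e1, e2, div_eq_inv_mul]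
  field_simp
  ring

theorem exponentIncrement_le {C : ℝ} (hC : ∀ x, 0 < x → ψ x ≤ C) {s : ℝ} (hs : 0 < s) :
    exponentIncrement ψ s ≤ C * Real.log 2 := by
  have hF := integral_exp_sub_exp_div (a := 1) (b := 2) one_pos two_pos
  rw [div_one] at hF
  rw [mul_comm, ← hF, exponentIncrement, ← integral_mul_const]
  refine setIntegral_mono_on (integrableOn_exponentIncrement hint hs)
    ((integrableOn_exp_sub_exp_div one_pos two_pos).mul_const C) measurableSet_Ioi
    fun x (hx : 0 < x) => ?_
  exact mul_le_mul_of_nonneg_left (hC _ (div_pos hx hs)) (exp_neg_sub_exp_neg_two_mul_pos hx).le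

theorem tendsto_exponentIncrement {C L : ℝ} (h0 : ∀ x ∈ Ioi (0 : ℝ), 0 ≤ ψ x)
    (hC : ∀ x, 0 < x → ψ x ≤ C) (hL : Tendsto ψ (𝓝[>] 0) (𝓝 L)) :
    Tendsto (exponentIncrement ψ) atTop (𝓝 (Real.log 2 * L)) := by
  have hF := integral_exp_sub_exp_div (a := 1) (b := 2) one_pos two_pos
  rw [div_one] at hF
  rw [← hF, ← integral_mul_const]
  refine tendsto_integral_filter_of_dominated_convergence
    (fun x => (Real.exp (-(1 * x)) - Real.exp (-(2 * x))) / x * C) ?_ ?_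
    ((integrableOn_exp_sub_exp_div one_pos two_pos).mul_const C) ?_
  · filter_upwards [eventually_gt_atTop 0] with s hs
    exact (integrableOn_exponentIncrement hint hs).aestronglyMeasurable
  · filter_upwards [eventually_gt_atTop 0] with s hs
    refine (ae_restrict_mem measurableSet_Ioi).mono fun x (hx : 0 < x) => ?_
    have hp := (exp_neg_sub_exp_neg_two_mul_pos hx).le
    have hxs : 0 < x / s := div_pos hx hs
    rw [Real.norm_of_nonneg (mul_nonneg hp (h0 _ hxs))]
    exact mul_le_mul_of_nonneg_left (hC _ hxs) hp
  · refine (ae_restrict_mem measurableSet_Ioi).mono fun x (hx : 0 < x) => ?_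
    refine Tendsto.const_mul _ (hL.comp (tendsto_nhdsWithin_iff.2 ⟨?_, ?_⟩))
    · exact tendsto_const_nhds.div_atTop tendsto_id
    · filter_upwards [eventually_gt_atTop 0] with s hs using div_pos hx hs

/-- For `x ≤ 1` monotonicity gives `ψ (x/s) ≥ ψ (1/s)`. This lets a bound on increments bound `ψ`
itself, which is not assumed bounded. -/
theorem exponentIncrement_ge (h0 : ∀ x ∈ Ioi (0 : ℝ), 0 ≤ ψ x) (hanti : AntitoneOn ψ (Ioi 0))
    {s : ℝ} (hs : 0 < s) :
    (∫ x in Ioc (0 : ℝ) 1, (Real.exp (-(1 * x)) - Real.exp (-(2 * x))) / x) * ψ s⁻¹ ≤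
      exponentIncrement ψ s := by
  have hi := integrableOn_exponentIncrement hint hs
  rw [← integral_mul_const]
  calc ∫ x in Ioc (0 : ℝ) 1, (Real.exp (-(1 * x)) - Real.exp (-(2 * x))) / x * ψ s⁻¹
      ≤ ∫ x in Ioc (0 : ℝ) 1,
          (Real.exp (-(1 * x)) - Real.exp (-(2 * x))) / x * ψ (x / s) := by
        refine setIntegral_mono_on (((integrableOn_exp_sub_exp_div one_pos two_pos).mono_set
          Ioc_subset_Ioi_self).mul_const _) (hi.mono_set Ioc_subset_Ioi_self) measurableSet_Ioc
          fun x hx => ?_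
        refine mul_le_mul_of_nonneg_left (hanti (div_pos hx.1 hs) (inv_pos.2 hs) ?_)
          (exp_neg_sub_exp_neg_two_mul_pos hx.1).le
        rw [div_eq_mul_inv]
        exact mul_le_of_le_one_left (inv_pos.2 hs).le hx.2
    _ ≤ exponentIncrement ψ s := by
        refine setIntegral_mono_set hi ?_ (LE.le.eventuallyLE Ioc_subset_Ioi_self)
        refine (ae_restrict_mem measurableSet_Ioi).mono fun x (hx : 0 < x) => ?_
        exact mul_nonneg (exp_neg_sub_exp_neg_two_mul_pos hx).le (h0 _ (div_pos hx hs))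

end

theorem setIntegral_Ioc_exp_sub_exp_div_pos :
    0 < ∫ x in Ioc (0 : ℝ) 1, (Real.exp (-(1 * x)) - Real.exp (-(2 * x))) / x := by
  have hi : IntegrableOn (fun x : ℝ => (Real.exp (-(1 * x)) - Real.exp (-(2 * x))) / x)
    (Ioc 0 1) := (integrableOn_exp_sub_exp_div one_pos two_pos).mono_set Ioc_subset_Ioi_self
  rw [← intervalIntegral.integral_of_le zero_le_one]
  exact intervalIntegral.intervalIntegral_pos_of_pos_on
    ((intervalIntegrable_iff_integrableOn_Ioc_of_le zero_le_one).2 hi)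
    (fun x hx => exp_neg_sub_exp_neg_two_mul_pos hx.1) zero_lt_one

theorem drift_eq_zero_and_tendsto_spectral {φ ψ : ℝ → ℝ} {a C L : ℝ}
    (hφ : ∀ s : ℝ, 0 ≤ s → IntegrableOn (fun x => (1 - Real.exp (-s * x)) * (φ x / x)) (Ioi 0))
    (hψ : ∀ s : ℝ, 0 ≤ s → IntegrableOn (fun x => (1 - Real.exp (-s * x)) * (ψ x / x)) (Ioi 0))
    (hφ0 : ∀ x ∈ Ioi (0 : ℝ), 0 ≤ φ x) (hφC : ∀ x, 0 < x → φ x ≤ C)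
    (hφL : Tendsto φ (𝓝[>] 0) (𝓝 L)) (hψ0 : ∀ x ∈ Ioi (0 : ℝ), 0 ≤ ψ x)
    (hψanti : AntitoneOn ψ (Ioi 0)) (ha : 0 ≤ a)
    (heq : ∀ s : ℝ, 0 ≤ s → ∫ x in Ioi (0 : ℝ), (1 - Real.exp (-s * x)) * (φ x / x) =
      a * s + ∫ x in Ioi (0 : ℝ), (1 - Real.exp (-s * x)) * (ψ x / x)) :
    a = 0 ∧ Tendsto ψ (𝓝[>] 0) (𝓝 L) := by
  have hinc : ∀ s, 0 < s → exponentIncrement φ s = a * s + exponentIncrement ψ s := by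
    intro s hs
    have h1 := heq s hs.le
    have h2 := heq (2 * s) (by positivity)
    have h3 := integral_sub_eq_exponentIncrement hφ hs
    have h4 := integral_sub_eq_exponentIncrement hψ hs
    linarith
  have hm := setIntegral_Ioc_exp_sub_exp_div_pos
  set m := ∫ x in Ioc (0 : ℝ) 1, (Real.exp (-(1 * x)) - Real.exp (-(2 * x))) / x
  have ha0 : a = 0 := by
    by_contra hne
    have hpos : 0 < a := lt_of_le_of_ne ha (Ne.symm hne)
    have hC : 0 ≤ C := (hφ0 1 (mem_Ioi.2 one_pos)).trans (hφC 1 one_pos)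
    have hlog : 0 ≤ Real.log 2 := Real.log_nonneg one_le_two
    -- At this `s` the drift contributes `C log 2 + 1`, more than the whole increment of `φ` can be.
    have hs : 0 < (C * Real.log 2 + 1) / a := by positivity
    have h1 := hinc _ hs
    have h2 := exponentIncrement_le hφ hφC hs
    have h3 := exponentIncrement_ge hψ hψ0 hψanti hs
    have h4 := mul_nonneg hm.le (hψ0 _ (inv_pos.2 hs))
    rw [mul_div_cancel₀ _ hpos.ne'] at h1
    linarith
  refine ⟨ha0, ?_⟩
  have hbd : ∀ x, 0 < x → ψ x ≤ C * Real.log 2 / m := by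
    intro x hx
    have h1 := hinc _ (inv_pos.2 hx)
    have h2 := exponentIncrement_le hφ hφC (inv_pos.2 hx)
    have h3 := exponentIncrement_ge hψ hψ0 hψanti (inv_pos.2 hx)
    rw [inv_inv] at h3
    rw [ha0, zero_mul, zero_add] at h1
    rw [le_div_iff₀ hm]
    linarith
  have hlim : Tendsto ψ (𝓝[>] 0) (𝓝 (sSup (ψ '' Ioi 0))) :=
    hψanti.tendsto_nhdsGT ⟨C * Real.log 2 / m, by rintro _ ⟨x, hx, rfl⟩; exact hbd x hx⟩
  have t1 := tendsto_exponentIncrement hφ hφ0 hφC hφL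
  have t2 := tendsto_exponentIncrement hψ hψ0 hbd hlim
  have t3 : Tendsto (exponentIncrement ψ) atTop (𝓝 (Real.log 2 * L)) := by
    refine t1.congr' ?_
    filter_upwards [eventually_gt_atTop 0] with s hs
    rw [hinc s hs, ha0, zero_mul, zero_add]
  have := mul_left_cancel₀ (Real.log_pos one_lt_two).ne' (tendsto_nhds_unique t2 t3)
  rwa [this] at hlim

/-! ### The ray integral `∫₀¹ (1 + tζ)^s t^(c-1) dt` -/

/-- Nonnegativity of the derivative yields integrability for free; it will be applied to `b^s` with
`s < 0`, which is singular at the right endpoint. -/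
theorem integral_eq_sub_of_deriv_nonneg_of_tendsto {f f' : ℝ → ℝ} {a b fa fb : ℝ} (hab : a < b)
    (hderiv : ∀ x ∈ Ioo a b, HasDerivAt f (f' x) x) (hpos : ∀ x ∈ Ioo a b, 0 ≤ f' x)
    (ha : Tendsto f (𝓝[>] a) (𝓝 fa)) (hb : Tendsto f (𝓝[<] b) (𝓝 fb)) :
    IntervalIntegrable f' volume a b ∧ ∫ x in a..b, f' x = fb - fa := by
  have hcont : ContinuousOn f (Ioo a b) := fun x hx =>
    (hderiv x hx).continuousAt.continuousWithinAt
  have hint : IntervalIntegrable f' volume a b := by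
    rw [intervalIntegrable_iff_integrableOn_Ioc_of_le hab.le]
    refine intervalIntegral.integrableOn_deriv_of_nonneg
      (continuousOn_Icc_extendFrom_Ioo hcont ha hb) (fun x hx => ?_) hpos
    refine (hderiv x hx).congr_of_eventuallyEq ?_
    filter_upwards [Ioo_mem_nhds hx.1 hx.2] with y hy using extendFrom_extends hcont y hy
  exact ⟨hint, intervalIntegral.integral_eq_sub_of_hasDerivAt_of_tendsto hab hderiv hint ha hb⟩

/-- The integral `∫₀¹ (1 + tζ)^s t^(c-1) dt`. -/
noncomputable def rayIntegral (s c : ℝ) (ζ : ℂ) : ℂ :=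
  ∫ t in Ioo (0 : ℝ) 1, (1 + t * ζ) ^ (s : ℂ) * ((t ^ (c - 1) : ℝ) : ℂ)

theorem integrableOn_rpow_Ioo {c : ℝ} (hc : 0 < c) :
    IntegrableOn (fun t : ℝ => t ^ (c - 1)) (Ioo 0 1) := by
  have h := intervalIntegral.intervalIntegrable_rpow' (a := 0) (b := 1) (r := c - 1) (by linarith)
  rw [intervalIntegrable_iff_integrableOn_Ioo_of_le zero_le_one] at h
  exact h

theorem one_add_mul_mem_slitPlane {ζ : ℂ} (hζ : ζ ∈ Complex.slitPlane) {t : ℝ} (ht : 0 ≤ t) :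
    1 + t * ζ ∈ Complex.slitPlane := by
  rw [Complex.mem_slitPlane_iff] at hζ ⊢
  simp only [Complex.add_re, Complex.one_re, Complex.re_ofReal_mul, Complex.add_im, Complex.one_im,
    Complex.im_ofReal_mul, zero_add]
  rcases hζ with h | h
  · exact Or.inl (by positivity)
  · rcases ht.eq_or_lt with rfl | ht
    · left; simp
    · exact Or.inr (mul_ne_zero ht.ne' h)

/-- Compactness of `[0,1]` times a closed ball. The lower bound dominates negative powers of `1 +
tζ` when differentiating under the integral. -/
theorem exists_norm_one_add_mul_ge {ζ₀ : ℂ} (hζ₀ : ζ₀ ∈ Complex.slitPlane) :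
    ∃ ε > 0, ∃ δ > 0, ∀ ζ ∈ Metric.ball ζ₀ ε, ζ ∈ Complex.slitPlane ∧
      ∀ t ∈ Icc (0 : ℝ) 1, δ ≤ ‖1 + t * ζ‖ := by
  obtain ⟨ε, hε, hball⟩ := Metric.nhds_basis_closedBall.mem_iff.1
    (Complex.isOpen_slitPlane.mem_nhds hζ₀)
  have hcomp : IsCompact (Icc (0 : ℝ) 1 ×ˢ Metric.closedBall ζ₀ ε) :=
    isCompact_Icc.prod (isCompact_closedBall ζ₀ ε)
  obtain ⟨p, hp, hmin⟩ := hcomp.exists_isMinOn (f := fun p : ℝ × ℂ => ‖1 + p.1 * p.2‖)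
    ⟨(0, ζ₀), ⟨⟨le_rfl, zero_le_one⟩, Metric.mem_closedBall_self hε.le⟩⟩
    (Continuous.continuousOn (by fun_prop))
  refine ⟨ε, hε, ‖1 + p.1 * p.2‖, norm_pos_iff.2 (Complex.slitPlane_ne_zero
    (one_add_mul_mem_slitPlane (hball hp.2) hp.1.1)), fun ζ hζ => ?_⟩
  have hζ' := Metric.ball_subset_closedBall hζ
  exact ⟨hball hζ', fun t ht => hmin (show (t, ζ) ∈ Icc (0 : ℝ) 1 ×ˢ _ from ⟨ht, hζ'⟩)⟩

theorem hasDerivAt_one_add_mul_cpow {ζ : ℂ} (hζ : ζ ∈ Complex.slitPlane) {t : ℝ} (ht : 0 ≤ t)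
    (s : ℂ) : HasDerivAt (fun z : ℂ => (1 + t * z) ^ s) (s * (1 + t * ζ) ^ (s - 1) * t) ζ := by
  have h : HasDerivAt (fun z : ℂ => 1 + t * z) t ζ := by
    simpa using ((hasDerivAt_id ζ).const_mul (t : ℂ)).const_add 1
  exact h.cpow_const (one_add_mul_mem_slitPlane hζ ht)

section

variable {s c : ℝ} (hs : s < 0) (hc : 0 < c)

include hs hc

theorem integrableOn_rayIntegral {ζ : ℂ} (hζ : ζ ∈ Complex.slitPlane) :
    IntegrableOn (fun t : ℝ => (1 + t * ζ) ^ (s : ℂ) * ((t ^ (c - 1) : ℝ) : ℂ)) (Ioo 0 1) := by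
  obtain ⟨ε, hε, δ, hδ, hb⟩ := exists_norm_one_add_mul_ge hζ
  refine Integrable.mono' ((integrableOn_rpow_Ioo hc).const_mul (δ ^ s))
    (Measurable.aestronglyMeasurable (by fun_prop)) ?_
  refine (ae_restrict_mem measurableSet_Ioo).mono fun t ht => ?_
  rw [norm_mul, Complex.norm_cpow_real, Complex.norm_real,
    Real.norm_of_nonneg (Real.rpow_nonneg ht.1.le _)]
  exact mul_le_mul_of_nonneg_right (Real.rpow_le_rpow_of_nonpos hδ
    ((hb ζ (Metric.mem_ball_self hε)).2 t ⟨ht.1.le, ht.2.le⟩) hs.le) (Real.rpow_nonneg ht.1.le _)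

theorem hasDerivAt_rayIntegral {ζ₀ : ℂ} (hζ₀ : ζ₀ ∈ Complex.slitPlane) :
    IntegrableOn (fun t : ℝ =>
      (s * (1 + t * ζ₀) ^ ((s : ℂ) - 1) * t) * ((t ^ (c - 1) : ℝ) : ℂ)) (Ioo 0 1) ∧
    HasDerivAt (rayIntegral s c) (∫ t in Ioo (0 : ℝ) 1,
      (s * (1 + t * ζ₀) ^ ((s : ℂ) - 1) * t) * ((t ^ (c - 1) : ℝ) : ℂ)) ζ₀ := by
  obtain ⟨ε, hε, δ, hδ, hb⟩ := exists_norm_one_add_mul_ge hζ₀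
  refine hasDerivAt_integral_of_dominated_loc_of_deriv_le (Metric.ball_mem_nhds ζ₀ hε)
    (F := fun ζ t => (1 + t * ζ) ^ (s : ℂ) * ((t ^ (c - 1) : ℝ) : ℂ))
    (F' := fun ζ t => (s * (1 + t * ζ) ^ ((s : ℂ) - 1) * t) * ((t ^ (c - 1) : ℝ) : ℂ))
    (bound := fun t => |s| * δ ^ (s - 1) * t ^ (c - 1))
    (Eventually.of_forall fun ζ => Measurable.aestronglyMeasurable (by fun_prop))
    (integrableOn_rayIntegral hs hc hζ₀)
    (Measurable.aestronglyMeasurable (by fun_prop)) ?_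
    ((integrableOn_rpow_Ioo hc).const_mul _) ?_
  · refine (ae_restrict_mem measurableSet_Ioo).mono fun t ht ζ hζ => ?_
    have hpow := Real.rpow_nonneg ht.1.le (c - 1)
    rw [norm_mul, norm_mul, norm_mul, Complex.norm_real, Complex.norm_real, Complex.norm_real,
      Real.norm_of_nonneg hpow, Real.norm_of_nonneg ht.1.le, Real.norm_eq_abs,
      show ((s : ℂ) - 1) = ((s - 1 : ℝ) : ℂ) by push_cast; ring, Complex.norm_cpow_real]
    refine mul_le_mul_of_nonneg_right ?_ hpow
    have h1 : ‖1 + t * ζ‖ ^ (s - 1) ≤ δ ^ (s - 1) := Real.rpow_le_rpow_of_nonpos hδ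
      ((hb ζ hζ).2 t ⟨ht.1.le, ht.2.le⟩) (by linarith)
    calc |s| * ‖1 + t * ζ‖ ^ (s - 1) * t ≤ |s| * ‖1 + t * ζ‖ ^ (s - 1) * 1 :=
          mul_le_mul_of_nonneg_left ht.2.le (by positivity)
      _ ≤ |s| * δ ^ (s - 1) := by
          rw [mul_one]; exact mul_le_mul_of_nonneg_left h1 (abs_nonneg s)
  · refine (ae_restrict_mem measurableSet_Ioo).mono fun t ht ζ hζ => ?_
    exact (hasDerivAt_one_add_mul_cpow (hb ζ hζ).1 ht.1.le s).mul_const _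

/-- The integration by parts identity `ζ G' + c G = (1 + ζ)^s` for the ray integral `G`. -/
theorem mul_deriv_rayIntegral_add {ζ : ℂ} (hζ : ζ ∈ Complex.slitPlane) :
    ζ * (∫ t in Ioo (0 : ℝ) 1,
      (s * (1 + t * ζ) ^ ((s : ℂ) - 1) * t) * ((t ^ (c - 1) : ℝ) : ℂ)) + c * rayIntegral s c ζ =
      (1 + ζ) ^ (s : ℂ) := by
  have hi := (hasDerivAt_rayIntegral hs hc hζ).1
  have hj := integrableOn_rayIntegral hs hc hζ
  rw [rayIntegral, ← integral_const_mul, ← integral_const_mul,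
    ← integral_add (hi.const_mul ζ) (hj.const_mul (c : ℂ)), ← integral_Ioc_eq_integral_Ioo,
    ← intervalIntegral.integral_of_le zero_le_one]
  have hmem : ∀ t : ℝ, 0 ≤ t → 1 + t * ζ ∈ Complex.slitPlane := fun t ht =>
    one_add_mul_mem_slitPlane hζ ht
  have key := intervalIntegral.integral_eq_sub_of_hasDerivAt_of_le (a := 0) (b := 1) zero_le_one
    (f := fun t : ℝ => (1 + t * ζ) ^ (s : ℂ) * ((t ^ c : ℝ) : ℂ))
    (f' := fun t : ℝ => ζ * ((s * (1 + t * ζ) ^ ((s : ℂ) - 1) * t) * ((t ^ (c - 1) : ℝ) : ℂ)) +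
      c * ((1 + t * ζ) ^ (s : ℂ) * ((t ^ (c - 1) : ℝ) : ℂ))) ?_ ?_ ?_
  · rw [key]
    simp [Real.zero_rpow hc.ne']
  · refine ContinuousOn.mul ?_ ?_
    · exact ContinuousOn.cpow_const (by fun_prop) fun t ht => hmem t ht.1
    · exact Complex.continuous_ofReal.comp_continuousOn
        (ContinuousOn.rpow_const continuousOn_id fun t _ => Or.inr hc.le)
  · intro t ht
    have h1 : HasDerivAt (fun z : ℂ => (1 + z * ζ) ^ (s : ℂ))
        (s * (1 + t * ζ) ^ ((s : ℂ) - 1) * ζ) (t : ℂ) := by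
      have h : HasDerivAt (fun z : ℂ => 1 + z * ζ) ζ (t : ℂ) := by
        simpa using ((hasDerivAt_id (t : ℂ)).mul_const ζ).const_add 1
      exact h.cpow_const (hmem t ht.1.le)
    have h2 := (Real.hasDerivAt_rpow_const (p := c) (Or.inl ht.1.ne')).ofReal_comp
    refine (h1.comp_ofReal.mul h2).congr_deriv ?_
    have h3 : t ^ c = t * t ^ (c - 1) := by
      rw [← Real.rpow_one_add' ht.1.le (by linarith)]; ring_nf
    rw [h3]
    push_cast
    ring
  · rw [intervalIntegrable_iff_integrableOn_Ioo_of_le zero_le_one]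
    exact (hi.const_mul ζ).add (hj.const_mul (c : ℂ))

/-- Formally `z^c * rayIntegral s c z` is `∫ w^{c-1} (1+w)^s dw` along the segment from `0` to `z`,
hence a primitive. -/
theorem hasDerivAt_cpow_mul_rayIntegral {ζ : ℂ} (hζ : ζ ∈ Complex.slitPlane) :
    HasDerivAt (fun z => z ^ (c : ℂ) * rayIntegral s c z)
      (ζ ^ (c : ℂ) * (1 + ζ) ^ (s : ℂ) / ζ) ζ := by
  have h1 := (hasDerivAt_id ζ).cpow_const (c := (c : ℂ)) hζ
  refine (h1.mul (hasDerivAt_rayIntegral hs hc hζ).2).congr_deriv ?_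
  rw [← mul_deriv_rayIntegral_add hs hc hζ]
  have h0 := Complex.slitPlane_ne_zero hζ
  simp only [id, mul_one]
  rw [Complex.cpow_sub _ _ h0, Complex.cpow_one]
  field_simp
  ring

end

theorem im_cpow_mul_rayIntegral_ofReal (s c : ℝ) {x : ℝ} (hx : 0 ≤ x) :
    ((x : ℂ) ^ (c : ℂ) * rayIntegral s c x).im = 0 := by
  have h : rayIntegral s c x =
      ((∫ t in Ioo (0 : ℝ) 1, (1 + t * x) ^ s * t ^ (c - 1) : ℝ) : ℂ) := by
    rw [rayIntegral, ← integral_complex_ofReal]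
    refine setIntegral_congr_fun measurableSet_Ioo fun t ht => ?_
    have : 0 ≤ 1 + t * x := by have := ht.1; positivity
    simp only [Complex.ofReal_mul]
    rw [Complex.ofReal_cpow this]
    push_cast
    ring
  rw [h, ← Complex.ofReal_cpow hx, ← Complex.ofReal_mul, Complex.ofReal_im]

/-! ### The Beta integral -/

theorem integral_beta {s c : ℝ} (hs : -1 < s) (hc : 0 < c) :
    IntegrableOn (fun t : ℝ => (1 - t) ^ s * t ^ (c - 1)) (Ioo 0 1) ∧
    ∫ t in Ioo (0 : ℝ) 1, (1 - t) ^ s * t ^ (c - 1) =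
      Real.Gamma c * Real.Gamma (s + 1) / Real.Gamma (c + (s + 1)) := by
  have hc' : 0 < (c : ℂ).re := by simpa
  have hs' : 0 < ((s + 1 : ℝ) : ℂ).re := by rw [Complex.ofReal_re]; linarith
  have hcongr : EqOn (fun t : ℝ => (t : ℂ) ^ ((c : ℂ) - 1) * (1 - (t : ℂ)) ^ (((s + 1 : ℝ) : ℂ) - 1))
      (fun t : ℝ => (((1 - t) ^ s * t ^ (c - 1) : ℝ) : ℂ)) (Ioo 0 1) := fun t ht => by
    have h1 : 0 ≤ 1 - t := by linarith [ht.2]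
    simp only [Complex.ofReal_mul]
    rw [Complex.ofReal_cpow h1, Complex.ofReal_cpow ht.1.le]
    push_cast
    ring_nf
  have hi := Complex.betaIntegral_convergent hc' hs'
  rw [intervalIntegrable_iff_integrableOn_Ioo_of_le zero_le_one] at hi
  have hi' := hi.congr_fun hcongr measurableSet_Ioo
  have hI := Complex.betaIntegral_eq_Gamma_mul_div _ _ hc' hs'
  rw [Complex.betaIntegral, intervalIntegral.integral_of_le zero_le_one,
    integral_Ioc_eq_integral_Ioo, setIntegral_congr_fun measurableSet_Ioo hcongr,
    integral_complex_ofReal, ← Complex.ofReal_add, Complex.Gamma_ofReal, Complex.Gamma_ofReal,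
    Complex.Gamma_ofReal, ← Complex.ofReal_mul, ← Complex.ofReal_div] at hI
  exact ⟨by simpa [IntegrableOn] using hi'.re, Complex.ofReal_injective hI⟩

/-! ### The curve on which `ζ^c (1 + ζ)^s` is real -/

/-- The modulus `sin(βy) / sin((1-β)y)` of the curve. -/
noncomputable def curveRadius (β y : ℝ) : ℝ := Real.sin (β * y) / Real.sin ((1 - β) * y)

/-- The curve in the upper half-plane on which `arg (1 + ζ) = β arg ζ`. -/
noncomputable def kanterCurve (β y : ℝ) : ℂ := curveRadius β y * Complex.exp (y * Complex.I)

theorem ofReal_mul_exp_cpow {r θ : ℝ} (hr : 0 < r) (h1 : -Real.pi < θ) (h2 : θ ≤ Real.pi) (p : ℝ) :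
    ((r : ℂ) * Complex.exp (θ * Complex.I)) ^ (p : ℂ) =
      ((r ^ p : ℝ) : ℂ) * Complex.exp ((p * θ : ℝ) * Complex.I) := by
  have h : (r : ℂ) * Complex.exp (θ * Complex.I) =
      Complex.exp ((Real.log r : ℝ) + θ * Complex.I) := by
    rw [Complex.exp_add, ← Complex.ofReal_exp, Real.exp_log hr]
  rw [h, Complex.cpow_def_of_ne_zero (Complex.exp_ne_zero _),
    Complex.log_exp (by simpa using h1) (by simpa using h2), Real.rpow_def_of_pos hr,
    Complex.ofReal_exp, ← Complex.exp_add]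
  congr 1
  push_cast
  ring

section

variable {β : ℝ} (hβ : β ∈ Ioo (0 : ℝ) 1)

include hβ

theorem sin_mul_pos {y : ℝ} (hy : y ∈ Ioo 0 Real.pi) : 0 < Real.sin (β * y) :=
  Real.sin_pos_of_pos_of_lt_pi (mul_pos hβ.1 hy.1) (by nlinarith [hβ.1, hβ.2, hy.1, hy.2])

theorem sin_one_sub_mul_pos {y : ℝ} (hy : y ∈ Ioo 0 Real.pi) : 0 < Real.sin ((1 - β) * y) :=
  sin_mul_pos (β := 1 - β) ⟨by linarith [hβ.2], by linarith [hβ.1]⟩ hy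

theorem curveRadius_pos {y : ℝ} (hy : y ∈ Ioo 0 Real.pi) : 0 < curveRadius β y :=
  div_pos (sin_mul_pos hβ hy) (sin_one_sub_mul_pos hβ hy)

theorem one_add_kanterCurve {y : ℝ} (hy : y ∈ Ioo 0 Real.pi) :
    1 + kanterCurve β y = ((Real.sin y / Real.sin ((1 - β) * y) : ℝ) : ℂ) *
      Complex.exp ((β * y : ℝ) * Complex.I) := by
  have h := (sin_one_sub_mul_pos hβ hy).ne'
  have h1 : Real.sin ((1 - β) * y) =
      Real.sin y * Real.cos (β * y) - Real.cos y * Real.sin (β * y) := by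
    rw [← Real.sin_sub]; ring_nf
  rw [kanterCurve, curveRadius, Complex.exp_mul_I, Complex.exp_mul_I, ← Complex.ofReal_cos,
    ← Complex.ofReal_cos, ← Complex.ofReal_sin, ← Complex.ofReal_sin]
  generalize Real.sin ((1 - β) * y) = d at h h1 ⊢
  apply Complex.ext
  · simp only [Complex.add_re, Complex.one_re, Complex.ofReal_re,
      Complex.mul_re, Complex.I_re, Complex.I_im, Complex.ofReal_im]
    field_simp
    linear_combination h1
  · simp only [Complex.add_im, Complex.one_im, Complex.ofReal_re,
      Complex.mul_im, Complex.I_re, Complex.I_im, Complex.ofReal_im]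
    field_simp
    ring

theorem kanterCurve_mem_slitPlane {y : ℝ} (hy : y ∈ Ioo 0 Real.pi) :
    kanterCurve β y ∈ Complex.slitPlane := by
  rw [Complex.mem_slitPlane_iff]
  right
  rw [kanterCurve, Complex.im_ofReal_mul, Complex.exp_ofReal_mul_I_im]
  exact (mul_pos (curveRadius_pos hβ hy) (Real.sin_pos_of_pos_of_lt_pi hy.1 hy.2)).ne'

theorem kanterB_div_pi_rpow {y : ℝ} (hy : y ∈ Ioo 0 Real.pi) (s : ℝ) :
    kanterB β (y / Real.pi) ^ s =
      curveRadius β y ^ (-β * s) * (Real.sin y / Real.sin ((1 - β) * y)) ^ s := by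
  have hpi := Real.pi_pos.ne'
  rw [kanterB, curveRadius, show Real.pi * (y / Real.pi) = y by field_simp,
    show Real.pi * β * (y / Real.pi) = β * y by field_simp,
    show Real.pi * (1 - β) * (y / Real.pi) = (1 - β) * y by field_simp]
  -- With the positive sines written as exponentials, the identity of powers becomes a polynomial
  -- identity of exponents.
  obtain ⟨p, hp⟩ : ∃ p, Real.exp p = Real.sin (β * y) := ⟨_, Real.exp_log (sin_mul_pos hβ hy)⟩
  obtain ⟨q, hq⟩ : ∃ q, Real.exp q = Real.sin ((1 - β) * y) :=
    ⟨_, Real.exp_log (sin_one_sub_mul_pos hβ hy)⟩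
  obtain ⟨r, hr⟩ : ∃ r, Real.exp r = Real.sin y :=
    ⟨_, Real.exp_log (Real.sin_pos_of_pos_of_lt_pi hy.1 hy.2)⟩
  rw [← hp, ← hq, ← hr, ← Real.exp_mul, ← Real.exp_mul, ← Real.exp_add, ← Real.exp_sub,
    ← Real.exp_sub, ← Real.exp_sub, ← Real.exp_mul, ← Real.exp_mul, ← Real.exp_mul, ← Real.exp_add]
  congr 1
  ring

/-- The phases `-βs·y` and `s·βy` cancel: this is what the curve is designed for. -/
theorem kanterCurve_cpow_mul {y : ℝ} (hy : y ∈ Ioo 0 Real.pi) (s : ℝ) :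
    kanterCurve β y ^ ((-β * s : ℝ) : ℂ) * (1 + kanterCurve β y) ^ (s : ℂ) =
      ((kanterB β (y / Real.pi) ^ s : ℝ) : ℂ) := by
  have hpi := Real.pi_pos
  have hr : 0 < Real.sin y / Real.sin ((1 - β) * y) :=
    div_pos (Real.sin_pos_of_pos_of_lt_pi hy.1 hy.2) (sin_one_sub_mul_pos hβ hy)
  have hby : 0 < β * y := mul_pos hβ.1 hy.1
  rw [one_add_kanterCurve hβ hy, ofReal_mul_exp_cpow hr (by linarith)
    (by nlinarith [hβ.1, hβ.2, hy.1, hy.2]), kanterCurve,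
    ofReal_mul_exp_cpow (curveRadius_pos hβ hy) (by linarith [hy.1]) hy.2.le,
    kanterB_div_pi_rpow hβ hy, mul_mul_mul_comm, ← Complex.ofReal_mul, ← Complex.exp_add]
  rw [show ((-β * s * y : ℝ) : ℂ) * Complex.I + ((s * (β * y) : ℝ) : ℂ) * Complex.I = 0 by
    push_cast; ring, Complex.exp_zero, mul_one]

/-- The logarithmic derivative has imaginary part `1` because `y` is the argument; its real part `r`
drops out later. -/
theorem hasDerivAt_kanterCurve {y : ℝ} (hy : y ∈ Ioo 0 Real.pi) :
    ∃ r : ℝ, HasDerivAt (kanterCurve β) (kanterCurve β y * (r + Complex.I)) y := by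
  have h0 := (sin_one_sub_mul_pos hβ hy).ne'
  have hd : DifferentiableAt ℝ (curveRadius β) y := by
    unfold curveRadius
    exact DifferentiableAt.div (by fun_prop) (by fun_prop) h0
  refine ⟨deriv (curveRadius β) y / curveRadius β y, ?_⟩
  have h1 := hd.hasDerivAt.ofReal_comp
  have h2 : HasDerivAt (fun z : ℂ => Complex.exp (z * Complex.I))
      (Complex.exp (y * Complex.I) * Complex.I) (y : ℂ) := by
    simpa using ((hasDerivAt_id (y : ℂ)).mul_const Complex.I).cexp
  refine (h1.mul h2.comp_ofReal).congr_deriv ?_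
  have h3 : (curveRadius β y : ℂ) ≠ 0 := Complex.ofReal_ne_zero.2 (curveRadius_pos hβ hy).ne'
  rw [kanterCurve]
  push_cast
  field_simp

theorem hasDerivAt_im_kanterCurve {s : ℝ} (hs : s < 0) {y : ℝ} (hy : y ∈ Ioo 0 Real.pi) :
    HasDerivAt (fun y => (kanterCurve β y ^ ((-β * s : ℝ) : ℂ) *
      rayIntegral s (-β * s) (kanterCurve β y)).im) (kanterB β (y / Real.pi) ^ s) y := by
  obtain ⟨r, hr⟩ := hasDerivAt_kanterCurve hβ hy
  have hmem := kanterCurve_mem_slitPlane hβ hy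
  have h1 := hasDerivAt_cpow_mul_rayIntegral hs (c := -β * s) (by nlinarith [hβ.1]) hmem
  rw [kanterCurve_cpow_mul hβ hy] at h1
  have h2 := h1.comp y hr
  have h3 := Complex.imCLM.hasFDerivAt.comp_hasDerivAt y h2
  refine h3.congr_deriv ?_
  have h4 : ((kanterB β (y / Real.pi) ^ s : ℝ) : ℂ) / kanterCurve β y *
      (kanterCurve β y * (r + Complex.I)) =
      ((kanterB β (y / Real.pi) ^ s : ℝ) : ℂ) * (r + Complex.I) := by
    have := Complex.slitPlane_ne_zero hmem
    field_simp
  rw [h4, Complex.imCLM_apply, Complex.im_ofReal_mul]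
  simp

/-! ### Boundary values at the two ends of the curve -/

theorem tendsto_curveRadius_zero :
    Tendsto (curveRadius β) (𝓝[>] 0) (𝓝 (β / (1 - β))) := by
  have h : ∀ c : ℝ, Tendsto (fun y => Real.sin (c * y) / y) (𝓝[>] 0) (𝓝 c) := fun c => by
    have hd : HasDerivAt (fun y => Real.sin (c * y)) c 0 := by
      simpa using ((hasDerivAt_id (0 : ℝ)).const_mul c).sin
    simpa [div_eq_inv_mul] using hd.tendsto_slope_zero_right
  refine ((h β).div (h (1 - β)) (sub_pos.2 hβ.2).ne').congr' ?_
  filter_upwards [self_mem_nhdsWithin] with y (hy : 0 < y)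
  simp only [Pi.div_apply, curveRadius]
  rw [div_div_div_cancel_right₀ hy.ne']

theorem tendsto_curveRadius_pi : Tendsto (curveRadius β) (𝓝[<] Real.pi) (𝓝 1) := by
  have hpos : 0 < Real.sin (β * Real.pi) :=
    Real.sin_pos_of_pos_of_lt_pi (mul_pos hβ.1 Real.pi_pos) (by nlinarith [hβ.2, Real.pi_pos])
  have he : Real.sin ((1 - β) * Real.pi) = Real.sin (β * Real.pi) := by
    rw [← Real.sin_pi_sub]; ring_nf
  have hc : ContinuousAt (curveRadius β) Real.pi := by
    unfold curveRadius
    exact ContinuousAt.div (by fun_prop) (by fun_prop) (by rw [he]; exact hpos.ne')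
  have h1 : curveRadius β Real.pi = 1 := by rw [curveRadius, he, div_self hpos.ne']
  have := hc.tendsto.mono_left (nhdsWithin_le_nhds (s := Iio Real.pi))
  rwa [h1] at this

/-- Keeps the curve in the unit disc, so that `‖1 + tζ‖ ≥ 1 - t` and the Beta integrand dominates
near `ζ = -1`. -/
theorem curveRadius_le_one (hβ' : β ≤ 1 / 2) {y : ℝ} (hy : y ∈ Ioo 0 Real.pi) :
    curveRadius β y ≤ 1 := by
  rw [curveRadius, div_le_one (sin_one_sub_mul_pos hβ hy), ← sub_nonneg, Real.sin_sub_sin]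
  have h1 : 0 ≤ Real.sin (((1 - β) * y - β * y) / 2) :=
    Real.sin_nonneg_of_nonneg_of_le_pi (by nlinarith [hy.1]) (by nlinarith [hy.1, hy.2, hβ.1])
  have h2 : 0 ≤ Real.cos (((1 - β) * y + β * y) / 2) :=
    Real.cos_nonneg_of_neg_pi_div_two_le_of_le (by linarith [hy.1, Real.pi_pos])
      (by linarith [hy.2])
  positivity

theorem tendsto_im_kanterCurve_zero {s : ℝ} (hs : s < 0) :
    Tendsto (fun y => (kanterCurve β y ^ ((-β * s : ℝ) : ℂ) *
      rayIntegral s (-β * s) (kanterCurve β y)).im) (𝓝[>] 0) (𝓝 0) := by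
  have hpos : 0 < β / (1 - β) := div_pos hβ.1 (sub_pos.2 hβ.2)
  have hmem : ((β / (1 - β) : ℝ) : ℂ) ∈ Complex.slitPlane := Complex.ofReal_mem_slitPlane.2 hpos
  have h1 := (hasDerivAt_cpow_mul_rayIntegral hs (c := -β * s) (by nlinarith [hβ.1])
    hmem).continuousAt
  have h2 : Tendsto (kanterCurve β) (𝓝[>] 0) (𝓝 ((β / (1 - β) : ℝ) : ℂ)) := by
    have hc : Continuous fun y : ℝ => Complex.exp (y * Complex.I) := by fun_prop
    have he := (hc.tendsto 0).mono_left (nhdsWithin_le_nhds (s := Ioi 0))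
    have hr := (Complex.continuous_ofReal.tendsto _).comp (tendsto_curveRadius_zero hβ)
    simpa [kanterCurve] using! hr.mul he
  have h3 := (Complex.continuous_im.tendsto _).comp (h1.tendsto.comp h2)
  rwa [im_cpow_mul_rayIntegral_ofReal _ _ hpos.le] at h3

theorem tendsto_rayIntegral_kanterCurve_pi (hβ' : β ≤ 1 / 2) {s c : ℝ} (hs : -1 < s) (hs0 : s < 0)
    (hc : 0 < c) :
    Tendsto (fun y => rayIntegral s c (kanterCurve β y)) (𝓝[<] Real.pi)
      (𝓝 ((∫ t in Ioo (0 : ℝ) 1, (1 - t) ^ s * t ^ (c - 1) : ℝ) : ℂ)) := by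
  have hmem : ∀ᶠ y in 𝓝[<] Real.pi, y ∈ Ioo 0 Real.pi := Ioo_mem_nhdsLT Real.pi_pos
  rw [← integral_complex_ofReal]
  refine tendsto_integral_filter_of_dominated_convergence
    (fun t => (1 - t) ^ s * t ^ (c - 1)) ?_ ?_ (integral_beta hs hc).1 ?_
  · exact Eventually.of_forall fun y => Measurable.aestronglyMeasurable (by fun_prop)
  · filter_upwards [hmem] with y hy
    refine (ae_restrict_mem measurableSet_Ioo).mono fun t ht => ?_
    have hp := Real.rpow_nonneg ht.1.le (c - 1)
    rw [norm_mul, Complex.norm_cpow_real, Complex.norm_real, Real.norm_of_nonneg hp]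
    refine mul_le_mul_of_nonneg_right (Real.rpow_le_rpow_of_nonpos (by linarith [ht.2]) ?_ hs0.le) hp
    have hn : ‖(t : ℂ) * kanterCurve β y‖ ≤ t := by
      rw [norm_mul, kanterCurve, norm_mul, Complex.norm_exp_ofReal_mul_I, mul_one,
        Complex.norm_real, Complex.norm_real, Real.norm_of_nonneg ht.1.le,
        Real.norm_of_nonneg (curveRadius_pos hβ hy).le]
      exact mul_le_of_le_one_right ht.1.le (curveRadius_le_one hβ hβ' hy)
    have h1 := norm_sub_norm_le (1 : ℂ) (-(t * kanterCurve β y))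
    rw [norm_neg, norm_one, sub_neg_eq_add] at h1
    linarith
  · refine (ae_restrict_mem measurableSet_Ioo).mono fun t ht => ?_
    have hpos : 0 < 1 - t := by linarith [ht.2]
    have h2 : Tendsto (kanterCurve β) (𝓝[<] Real.pi) (𝓝 (-1)) := by
      have hc : Continuous fun y : ℝ => Complex.exp (y * Complex.I) := by fun_prop
      have he := (hc.tendsto Real.pi).mono_left (nhdsWithin_le_nhds (s := Iio Real.pi))
      have hr := (Complex.continuous_ofReal.tendsto _).comp (tendsto_curveRadius_pi hβ)
      simpa [kanterCurve] using! hr.mul he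
    have h3 : Tendsto (fun y => 1 + (t : ℂ) * kanterCurve β y) (𝓝[<] Real.pi)
        (𝓝 ((1 - t : ℝ) : ℂ)) := by
      have := (h2.const_mul (t : ℂ)).const_add 1
      convert this using 2
      push_cast
      ring
    have h4 := (h3.cpow (tendsto_const_nhds (x := (s : ℂ)))
      (Complex.ofReal_mem_slitPlane.2 hpos)).mul_const ((t ^ (c - 1) : ℝ) : ℂ)
    rwa [← Complex.ofReal_cpow hpos.le, ← Complex.ofReal_mul] at h4

theorem tendsto_im_kanterCurve_pi (hβ' : β ≤ 1 / 2) {s : ℝ} (hs : -1 < s) (hs0 : s < 0) :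
    Tendsto (fun y => (kanterCurve β y ^ ((-β * s : ℝ) : ℂ) *
      rayIntegral s (-β * s) (kanterCurve β y)).im) (𝓝[<] Real.pi)
      (𝓝 (Real.sin (-β * s * Real.pi) *
        ∫ t in Ioo (0 : ℝ) 1, (1 - t) ^ s * t ^ (-β * s - 1))) := by
  have hc : 0 < -β * s := by nlinarith [hβ.1]
  have h1 := tendsto_rayIntegral_kanterCurve_pi hβ hβ' hs hs0 hc
  have h2 : Tendsto (fun y => kanterCurve β y ^ ((-β * s : ℝ) : ℂ)) (𝓝[<] Real.pi)
      (𝓝 (Complex.exp ((-β * s * Real.pi : ℝ) * Complex.I))) := by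
    have hcont : Continuous fun y : ℝ => Complex.exp ((-β * s * y : ℝ) * Complex.I) := by fun_prop
    have he := (hcont.tendsto Real.pi).mono_left (nhdsWithin_le_nhds (s := Iio Real.pi))
    have hr := (Complex.continuous_ofReal.tendsto _).comp
      ((tendsto_curveRadius_pi hβ).rpow_const (p := -β * s) (Or.inl one_ne_zero))
    rw [Real.one_rpow, Complex.ofReal_one] at hr
    have h := hr.mul he
    rw [one_mul] at h
    refine h.congr' ?_
    filter_upwards [Ioo_mem_nhdsLT Real.pi_pos] with y hy
    rw [kanterCurve, ofReal_mul_exp_cpow (curveRadius_pos hβ hy)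
      (by linarith [hy.1, Real.pi_pos]) hy.2.le]
    rfl
  have h3 := (Complex.continuous_im.tendsto _).comp (h2.mul h1)
  rwa [Complex.im_mul_ofReal, Complex.exp_ofReal_mul_I_im] at h3

/-! ### Moments of order `-1 < s < 0` -/

theorem kanterB_pos {u : ℝ} (hu : u ∈ Ioo (0 : ℝ) 1) : 0 < kanterB β u := by
  have hy : Real.pi * u ∈ Ioo 0 Real.pi :=
    ⟨mul_pos Real.pi_pos hu.1, by nlinarith [Real.pi_pos, hu.2]⟩
  have h1 := sin_mul_pos hβ hy
  have h2 := sin_one_sub_mul_pos hβ hy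
  have h3 := Real.sin_pos_of_pos_of_lt_pi hy.1 hy.2
  rw [kanterB, show Real.pi * β * u = β * (Real.pi * u) by ring,
    show Real.pi * (1 - β) * u = (1 - β) * (Real.pi * u) by ring]
  positivity

theorem integral_kanterB_rpow_of_le_half (hβ' : β ≤ 1 / 2) {s : ℝ} (hs : -1 < s) (hs0 : s < 0) :
    IntegrableOn (fun u => kanterB β u ^ s) (Ioo 0 1) ∧
    ∫ u in Ioo (0 : ℝ) 1, kanterB β u ^ s =
      Real.Gamma (s + 1) / (Real.Gamma (β * s + 1) * Real.Gamma ((1 - β) * s + 1)) := by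
  have hpi := Real.pi_pos
  have hc : 0 < -β * s := by nlinarith [hβ.1]
  obtain ⟨hint, hI⟩ := integral_eq_sub_of_deriv_nonneg_of_tendsto Real.pi_pos
    (fun y hy => hasDerivAt_im_kanterCurve hβ hs0 hy)
    (fun y hy => Real.rpow_nonneg (kanterB_pos hβ
      ⟨div_pos hy.1 hpi, (div_lt_one hpi).2 hy.2⟩).le _)
    (tendsto_im_kanterCurve_zero hβ hs0) (tendsto_im_kanterCurve_pi hβ hβ' hs hs0)
  have e : ∀ u : ℝ, Real.pi * u / Real.pi = u := fun u => by field_simp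
  have hint' := hint.comp_mul_left (c := Real.pi)
  have hI' := intervalIntegral.integral_comp_mul_left (a := 0) (b := 1)
    (fun y => kanterB β (y / Real.pi) ^ s) hpi.ne'
  simp only [e, zero_div, div_self hpi.ne'] at hint'
  rw [intervalIntegrable_iff_integrableOn_Ioo_of_le zero_le_one] at hint'
  refine ⟨hint', ?_⟩
  simp only [e, mul_zero, mul_one] at hI'
  rw [hI, sub_zero, (integral_beta hs hc).2, intervalIntegral.integral_of_le zero_le_one,
    integral_Ioc_eq_integral_Ioo, smul_eq_mul] at hI'
  rw [hI']
  -- The integral is `sin(πc) B(c, s+1) / π` with `c = -βs`; reflection trades `Γ(c) sin(πc) / π`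
  -- for `1 / Γ(1 + βs)`.
  have hrefl := Real.Gamma_mul_Gamma_one_sub (-β * s)
  have hsin : 0 < Real.sin (-β * s * Real.pi) :=
    Real.sin_pos_of_pos_of_lt_pi (by positivity)
      (mul_lt_of_lt_one_left hpi (by nlinarith [hβ.1, hβ.2]))
  rw [show 1 - -β * s = β * s + 1 by ring, mul_comm Real.pi] at hrefl
  rw [show -β * s + (s + 1) = (1 - β) * s + 1 by ring]
  have g1 : 0 < Real.Gamma (β * s + 1) := Real.Gamma_pos_of_pos (by nlinarith [hβ.1, hβ.2])
  have g2 : 0 < Real.Gamma ((1 - β) * s + 1) := Real.Gamma_pos_of_pos (by nlinarith [hβ.1, hβ.2])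
  rw [eq_div_iff hsin.ne'] at hrefl
  generalize Real.Gamma (β * s + 1) = A at hrefl g1 ⊢
  generalize Real.Gamma ((1 - β) * s + 1) = B at g2 ⊢
  generalize Real.sin (-β * s * Real.pi) = S at hrefl ⊢
  rw [inv_mul_eq_div, div_eq_div_iff hpi.ne' (mul_pos g1 g2).ne', ← hrefl]
  field_simp

end

theorem kanterB_symm (β u : ℝ) : kanterB (1 - β) u = kanterB β u := by
  rw [kanterB, kanterB, sub_sub_cancel, mul_comm (Real.sin (Real.pi * (1 - β) * u) ^ (1 - β))]

theorem integral_kanterB_rpow {β : ℝ} (hβ : β ∈ Ioo (0 : ℝ) 1) {s : ℝ} (hs : -1 < s)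
    (hs0 : s < 0) :
    IntegrableOn (fun u => kanterB β u ^ s) (Ioo 0 1) ∧
    ∫ u in Ioo (0 : ℝ) 1, kanterB β u ^ s =
      Real.Gamma (s + 1) / (Real.Gamma (β * s + 1) * Real.Gamma ((1 - β) * s + 1)) := by
  rcases le_total β (1 / 2) with h | h
  · exact integral_kanterB_rpow_of_le_half hβ h hs hs0
  -- Both sides are invariant under `β ↦ 1 - β`.
  · have := integral_kanterB_rpow_of_le_half (β := 1 - β)
      ⟨by linarith [hβ.2], by linarith [hβ.1]⟩ (by linarith) hs hs0
    simp only [kanterB_symm, sub_sub_cancel] at this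
    rwa [mul_comm (Real.Gamma (β * s + 1))]

/-! ### Moments of the Kanter variable -/

theorem kanterKappa_pos {β : ℝ} (hβ : β ∈ Ioo (0 : ℝ) 1) : 0 < kanterKappa β :=
  mul_pos (Real.rpow_pos_of_pos hβ.1 _) (Real.rpow_pos_of_pos (sub_pos.2 hβ.2) _)

theorem mul_sin_le_sin_mul {c y : ℝ} (hc : c ∈ Ioo (0 : ℝ) 1) (hy : y ∈ Ioo 0 Real.pi) :
    c * Real.sin y ≤ Real.sin (c * y) := by
  have := strictConcaveOn_sin_Icc.concaveOn.2 ⟨hy.1.le, hy.2.le⟩ ⟨le_rfl, Real.pi_pos.le⟩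
    hc.1.le (sub_nonneg.2 hc.2.le) (by ring)
  simpa using this

/-- Raise the concavity bounds `c sin y ≤ sin (c y)`, for `c = β` and `c = 1 - β`, to the power `c`
and multiply; the exponents sum to `1`, leaving one `sin y`. This is the nonnegativity of `W`. -/
theorem kanterB_le_kanterKappa {β u : ℝ} (hβ : β ∈ Ioo (0 : ℝ) 1) (hu : u ∈ Ioo (0 : ℝ) 1) :
    kanterB β u ≤ kanterKappa β := by
  have hy : Real.pi * u ∈ Ioo 0 Real.pi :=
    ⟨mul_pos Real.pi_pos hu.1, by nlinarith [Real.pi_pos, hu.2]⟩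
  have hβ' : 1 - β ∈ Ioo (0 : ℝ) 1 := ⟨by linarith [hβ.2], by linarith [hβ.1]⟩
  have h0 := Real.sin_pos_of_pos_of_lt_pi hy.1 hy.2
  have h1 := mul_sin_le_sin_mul hβ hy
  have h2 := mul_sin_le_sin_mul hβ' hy
  rw [kanterB, show Real.pi * β * u = β * (Real.pi * u) by ring,
    show Real.pi * (1 - β) * u = (1 - β) * (Real.pi * u) by ring]
  have p1 := sin_mul_pos hβ hy
  have p2 := sin_mul_pos hβ' hy
  generalize Real.sin (Real.pi * u) = A at *
  have hb := Real.rpow_pos_of_pos hβ.1 β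
  have hb' := Real.rpow_pos_of_pos hβ'.1 (1 - β)
  have key : β ^ β * (1 - β) ^ (1 - β) * A ≤
      Real.sin (β * (Real.pi * u)) ^ β * Real.sin ((1 - β) * (Real.pi * u)) ^ (1 - β) := by
    have q1 := Real.rpow_le_rpow (mul_pos hβ.1 h0).le h1 hβ.1.le
    have q2 := Real.rpow_le_rpow (mul_pos hβ'.1 h0).le h2 hβ'.1.le
    refine le_trans (le_of_eq ?_) (mul_le_mul q1 q2 (by have := hβ'.1; positivity)
      (by positivity))
    rw [Real.mul_rpow hβ.1.le h0.le, Real.mul_rpow hβ'.1.le h0.le, mul_mul_mul_comm,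
      ← Real.rpow_add h0, add_sub_cancel, Real.rpow_one]
  rw [div_le_iff₀ (by positivity)]
  have hk : kanterKappa β * (β ^ β * (1 - β) ^ (1 - β)) = 1 := by
    rw [kanterKappa, mul_mul_mul_comm, ← Real.rpow_add hβ.1, ← Real.rpow_add hβ'.1]
    simp
  calc A = kanterKappa β * (β ^ β * (1 - β) ^ (1 - β) * A) := by rw [← mul_assoc, hk, one_mul]
    _ ≤ _ := mul_le_mul_of_nonneg_left key (kanterKappa_pos hβ).le

/-! ### Analytic continuation of the moment formula to `s > -1` -/

theorem measurable_kanterB (β : ℝ) : Measurable (kanterB β) := by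
  unfold kanterB; fun_prop

theorem exp_mul_log_kanterB_eq {β : ℝ} (hβ : β ∈ Ioo (0 : ℝ) 1) (s : ℝ) :
    EqOn (fun u => Real.exp (s * Real.log (kanterB β u))) (fun u => kanterB β u ^ s)
      (Ioo 0 1) := fun u hu => by
  simp only
  rw [Real.rpow_def_of_pos (kanterB_pos hβ hu), mul_comm]

theorem Ioi_subset_integrableExpSet {β : ℝ} (hβ : β ∈ Ioo (0 : ℝ) 1) :
    Ioi (-1) ⊆ ProbabilityTheory.integrableExpSet (fun u => Real.log (kanterB β u))
      (volume.restrict (Ioo 0 1)) := by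
  intro s (hs : -1 < s)
  change IntegrableOn (fun u => Real.exp (s * Real.log (kanterB β u))) (Ioo 0 1)
  rcases lt_or_ge s 0 with hs0 | hs0
  · exact (integral_kanterB_rpow hβ hs hs0).1.congr_fun (exp_mul_log_kanterB_eq hβ s).symm
      measurableSet_Ioo
  · have hm := measurable_kanterB β
    refine Measure.integrableOn_of_bounded (M := Real.exp (s * Real.log (kanterKappa β)))
      (by simp) (Measurable.aestronglyMeasurable (by fun_prop)) ?_
    refine (ae_restrict_mem measurableSet_Ioo).mono fun u hu => ?_
    rw [Real.norm_of_nonneg (Real.exp_pos _).le]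
    exact Real.exp_le_exp.2 (mul_le_mul_of_nonneg_left (Real.log_le_log (kanterB_pos hβ hu)
      (kanterB_le_kanterKappa hβ hu)) hs0)

theorem mgf_log_kanterB {β : ℝ} (hβ : β ∈ Ioo (0 : ℝ) 1) {s : ℝ} (hs : -1 < s) :
    ProbabilityTheory.mgf (fun u => Real.log (kanterB β u)) (volume.restrict (Ioo 0 1)) s =
      Real.Gamma (s + 1) / (Real.Gamma (β * s + 1) * Real.Gamma ((1 - β) * s + 1)) := by
  set X : ℝ → ℝ := fun u => Real.log (kanterB β u)
  set μ : Measure ℝ := volume.restrict (Ioo 0 1)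
  have hpos : ∀ {c x : ℝ}, 0 < c → c ≤ 1 → -1 < x → 0 < c * x + 1 := fun hc0 hc1 hx => by
    nlinarith
  have hβ' : 0 < 1 - β := sub_pos.2 hβ.2
  have hβ'' : 1 - β ≤ 1 := by linarith [hβ.1]
  have hΓ : ∀ {c : ℝ}, 0 < c → c ≤ 1 → ∀ x : ℝ, -1 < x → Real.Gamma (c * x + 1) ≠ 0 :=
    fun hc0 hc1 x hx => (Real.Gamma_pos_of_pos (hpos hc0 hc1 hx)).ne'
  set V : Set ℂ := {z | -1 < z.re}
  have hVopen : IsOpen V := isOpen_lt continuous_const Complex.continuous_re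
  have hVconn : IsPreconnected V := (convex_halfSpace_re_gt (-1)).isPreconnected
  have hdΓ : ∀ c : ℝ, 0 < c → c ≤ 1 →
      DifferentiableOn ℂ (fun z : ℂ => Complex.Gamma (c * z + 1)) V := by
    intro c hc0 hc1 z hz
    have hre : 0 < (c * z + 1 : ℂ).re := by
      simpa using hpos hc0 hc1 hz
    have h := Complex.differentiableAt_Gamma (c * z + 1) fun m hm => by
      rw [hm] at hre
      simp only [Complex.neg_re, Complex.natCast_re] at hre
      linarith [Nat.cast_nonneg (α := ℝ) m]
    exact (h.comp z (by fun_prop : DifferentiableAt ℂ (fun z : ℂ => c * z + 1) z)).differentiableWithinAt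
  have hdM : DifferentiableOn ℂ (ProbabilityTheory.complexMGF X μ) V :=
    ProbabilityTheory.differentiableOn_complexMGF.mono fun z hz =>
      interior_mono (Ioi_subset_integrableExpSet hβ) (by rw [interior_Ioi]; exact hz)
  have hf := ((hdM.mul (hdΓ β hβ.1 hβ.2.le)).mul (hdΓ (1 - β) hβ' hβ'')).analyticOnNhd hVopen
  have hg := (hdΓ 1 one_pos le_rfl).analyticOnNhd hVopen
  -- Denominators are cleared, so both sides are analytic on `Re z > -1` without discussing zeros of
  -- the complex Gamma function.
  have hreal : ∀ x : ℝ, -1 < x → x < 0 →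
      ProbabilityTheory.complexMGF X μ x * Complex.Gamma (β * x + 1) *
        Complex.Gamma ((1 - β : ℝ) * x + 1) = Complex.Gamma ((1 : ℝ) * x + 1) := by
    intro x hx hx0
    have h1 : ProbabilityTheory.mgf X μ x =
        Real.Gamma (x + 1) / (Real.Gamma (β * x + 1) * Real.Gamma ((1 - β) * x + 1)) := by
      rw [← (integral_kanterB_rpow hβ hx hx0).2]
      exact setIntegral_congr_fun measurableSet_Ioo (exp_mul_log_kanterB_eq hβ x)
    have g1 := hΓ hβ.1 hβ.2.le x hx
    have g2 := hΓ hβ' hβ'' x hx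
    rw [ProbabilityTheory.complexMGF_ofReal, h1]
    norm_cast
    rw [Complex.Gamma_ofReal, Complex.Gamma_ofReal, Complex.Gamma_ofReal]
    norm_cast
    rw [one_mul, mul_assoc, div_mul_cancel₀ _ (mul_ne_zero g1 g2)]
  -- The accumulation point for the identity theorem; any point of `(-1, 0)` would do.
  have hmap : Tendsto (fun x : ℝ => (x : ℂ)) (𝓝[≠] (-1 / 2)) (𝓝[≠] ((-1 / 2 : ℝ) : ℂ)) := by
    refine tendsto_nhdsWithin_iff.2 ⟨(Complex.continuous_ofReal.tendsto _).mono_left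
      nhdsWithin_le_nhds, ?_⟩
    filter_upwards [self_mem_nhdsWithin] with x hx
    simpa only [mem_compl_iff, mem_singleton_iff, Complex.ofReal_inj] using hx
  have hev : ∀ᶠ x : ℝ in 𝓝[≠] (-1 / 2), x ∈ Ioo (-1 : ℝ) 0 :=
    mem_nhdsWithin_of_mem_nhds (Ioo_mem_nhds (by norm_num) (by norm_num))
  have hEq := hf.eqOn_of_preconnected_of_frequently_eq hg hVconn
    (z₀ := ((-1 / 2 : ℝ) : ℂ)) (by simp only [V, mem_ofPred_eq, Complex.ofReal_re]; norm_num)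
    (hmap.frequently (hev.mono fun x hx => hreal x hx.1 hx.2).frequently)
  have h := hEq (show (s : ℂ) ∈ V by simpa [V] using hs)
  simp only [Pi.mul_apply] at h
  rw [ProbabilityTheory.complexMGF_ofReal] at h
  norm_cast at h
  rw [Complex.Gamma_ofReal, Complex.Gamma_ofReal, Complex.Gamma_ofReal] at h
  norm_cast at h
  rw [one_mul] at h
  rw [eq_div_iff (mul_ne_zero (hΓ hβ.1 hβ.2.le s hs) (hΓ hβ' hβ'' s hs)), ← mul_assoc, h]

/-! ### Transfer to the probability space -/

section

variable {Ω : Type*} [MeasurableSpace Ω] {P : Measure Ω} {U : Ω → ℝ}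
  (hU : pdf.IsUniform U (Ioo (0 : ℝ) 1) P volume)

include hU

theorem map_eq_restrict_of_isUniform : P.map U = volume.restrict (Ioo 0 1) := by
  have h : P.map U = ProbabilityTheory.cond volume (Ioo (0 : ℝ) 1) := hU
  rw [h, ProbabilityTheory.cond]
  simp

theorem aemeasurable_of_isUniform : AEMeasurable U P :=
  hU.aemeasurable (by simp) (by simp)

theorem ae_mem_Ioo_of_isUniform : ∀ᵐ ω ∂P, U ω ∈ Ioo (0 : ℝ) 1 := by
  refine ae_of_ae_map (aemeasurable_of_isUniform hU) (p := fun u => u ∈ Ioo (0 : ℝ) 1) ?_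
  rw [map_eq_restrict_of_isUniform hU]
  exact ae_restrict_mem measurableSet_Ioo

variable {β : ℝ} (hβ : β ∈ Ioo (0 : ℝ) 1)

include hβ

theorem kanterW_nonneg_ae : ∀ᵐ ω ∂P, 0 ≤ kanterW β U ω := by
  filter_upwards [ae_mem_Ioo_of_isUniform hU] with ω hω
  have hκ := kanterKappa_pos hβ
  refine neg_nonneg.2 (Real.log_nonpos ?_ ?_)
  · exact mul_nonneg (inv_pos.2 hκ).le (kanterB_pos hβ hω).le
  · rw [kanterK, inv_mul_le_one₀ hκ]
    exact kanterB_le_kanterKappa hβ hω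

theorem laplace_kanterW {s : ℝ} (hs : 0 ≤ s) :
    ∫ ω, Real.exp (-s * kanterW β U ω) ∂P =
      Real.exp (-∫ x in Ioi (0 : ℝ), (1 - Real.exp (-s * x)) * (kanterSpectral β x / x)) := by
  have hm := measurable_kanterB β
  have h1 : ∫ ω, Real.exp (-s * kanterW β U ω) ∂P =
      ∫ ω, Real.exp (-s * Real.log (kanterKappa β)) *
        Real.exp (s * Real.log (kanterB β (U ω))) ∂P := by
    refine integral_congr_ae ?_
    filter_upwards [ae_mem_Ioo_of_isUniform hU] with ω hω
    rw [kanterW, kanterK, Real.log_mul (inv_pos.2 (kanterKappa_pos hβ)).ne'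
      (kanterB_pos hβ hω).ne', Real.log_inv, ← Real.exp_add]
    congr 1
    ring
  have h2 : ∫ ω, Real.exp (s * Real.log (kanterB β (U ω))) ∂P =
      ProbabilityTheory.mgf (fun u => Real.log (kanterB β u)) (volume.restrict (Ioo 0 1)) s := by
    rw [ProbabilityTheory.mgf, ← map_eq_restrict_of_isUniform hU,
      integral_map (aemeasurable_of_isUniform hU) (Measurable.aestronglyMeasurable (by fun_prop))]
  rw [h1, integral_const_mul, h2, mgf_log_kanterB hβ (by linarith),
    exp_neg_integral_kanterSpectral hβ hs]

theorem isSelfDecomposableWith_kanterW :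
    IsSelfDecomposableWith P (kanterW β U) 0 (kanterSpectral β) where
  aemeasurable := by
    have hm : Measurable fun u => -Real.log ((kanterKappa β)⁻¹ * kanterB β u) := by
      have := measurable_kanterB β
      fun_prop
    exact hm.comp_aemeasurable (aemeasurable_of_isUniform hU)
  nonneg := kanterW_nonneg_ae hU hβ
  drift_nonneg := le_rfl
  spectral_nonneg := fun _ hx => kanterSpectral_nonneg hβ hx
  spectral_antitone := antitoneOn_kanterSpectral hβ
  integrable := fun _ hs => integrableOn_kanterSpectral hβ hs
  laplace := fun s hs => by rw [zero_mul, zero_add]; exact laplace_kanterW hU hβ hs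

end

/-! ### Conclusion: existence and uniqueness -/

theorem kanterSpectral_le_half {β x : ℝ} (hβ : β ∈ Ioo (0 : ℝ) 1) (hx : 0 < x) :
    kanterSpectral β x ≤ 1 / 2 := by
  refine ge_of_tendsto (tendsto_kanterSpectral_zero hβ) ?_
  filter_upwards [Ioo_mem_nhdsGT hx] with y hy
  exact antitoneOn_kanterSpectral hβ hy.1 hx hy.2.le

theorem lemma1 {Ω : Type*} [MeasurableSpace Ω] (P : Measure Ω) [IsProbabilityMeasure P]
    (U : Ω → ℝ) (hU : pdf.IsUniform U (Ioo (0 : ℝ) 1) P volume)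
    (β : ℝ) (hβ : β ∈ Ioo (0 : ℝ) 1) :
    (∃ φ : ℝ → ℝ, IsSelfDecomposableWith P (kanterW β U) 0 φ ∧
      AntitoneOn φ (Ioi 0) ∧ Tendsto φ (𝓝[>] 0) (𝓝 (1 / 2))) ∧
    (∀ (a : ℝ) (φ : ℝ → ℝ), IsSelfDecomposableWith P (kanterW β U) a φ →
      a = 0 ∧ Tendsto φ (𝓝[>] 0) (𝓝 (1 / 2))) := by
  refine ⟨⟨kanterSpectral β, isSelfDecomposableWith_kanterW hU hβ, antitoneOn_kanterSpectral hβ,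
    tendsto_kanterSpectral_zero hβ⟩, fun a ψ h => ?_⟩
  refine drift_eq_zero_and_tendsto_spectral (fun s hs => integrableOn_kanterSpectral hβ hs)
    h.integrable (fun x hx => kanterSpectral_nonneg hβ hx) (fun x hx => kanterSpectral_le_half hβ hx)
    (tendsto_kanterSpectral_zero hβ) h.spectral_nonneg h.spectral_antitone h.drift_nonneg
    fun s hs => ?_
  have h1 := (laplace_kanterW hU hβ hs).symm.trans (h.laplace s hs)
  exact neg_injective (Real.exp_injective h1)
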